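/- Four-person "Closest Wins" game. Each of four players pays one unit and names a number in $[0,1]$; a target $r$ is drawn uniformly from $[0,1]$, and the players whose guess is closest to $r$ share the pot of four units equally. For guesses $\mathbf{x}=(x_1,\dots,x_4)$ let $A_i(\mathbf{x})$ be the expected net payoff of player $i$ (so $4/k-1$ for each of $k$ winners and $-1$ for every other player, averaged over $r$). A (mixed) strategy is a probability measure on $[0,1]$, or equivalently its cumulative distribution function (CDF). The players choose independently. There is a strategy $\mu$, with CDF $F$, such that all four players using $\mu$ is a Nash equilibrium: if the three opponents of a player use $\mu$, then no strategy gives that player a larger expected payoff than $\mu$ does. In this equilibrium every player's expected payoff is $0$. Moreover: 1. $F\left(\tfrac12-\tfrac t2\right)=1-F\left(\tfrac12+\tfrac t2\right)$ for all real $t$. 2. The support of $\mu$ is an interval $[\alpha,\beta]$ with $|\alpha-0.174989|\le 5\cdot10^{-7}$ and $|\beta-0.825011|\le 5\cdot10^{-7}$. 3. There are real numbers $c_0,c_1,c_2,\dots$ such that $$F(x)=\frac12+\sum_{k=0}^{\infty}c_k(2x-1)^{2k+1}\qquad(\alpha\le x\le\beta),$$ where each of $c_0,\dots,c_7$ differs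 by at most $5\cdot10^{-6}$ from the corresponding entry of $$0.636459,\ 0.214848,\ 0.144471,\ 0.123155,\ 0.118372,\ 0.122339,\ 0.132742,\ 0.149142.$$ 4. The symmetrized function $\widehat F(t)=F\left(\tfrac12+\tfrac t2\right)-F\left(\tfrac12-\tfrac t2\right)$ satisfies, for all $t\in(2\alpha-1,2\beta-1)$, $$\begin{aligned}0={}&-18\widehat F(\widehat F')^4-12t(\widehat F')^5+21(\widehat F')^2\widehat F''+9\widehat F^2(\widehat F')^2\widehat F''\\&-9\widehat F(\widehat F'')^2-3\widehat F^3(\widehat F'')^2+3\widehat F\widehat F'\widehat F'''+\widehat F^3\widehat F'\widehat F'''.\end{aligned}$$ -/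

import Mathlib

namespace ClosestWins

open MeasureTheory

noncomputable section

/-- Player `i` wins for the target `r` when nobody's guess is closer to `r`. -/
def Wins {n : ℕ} (x : Fin n → ℝ) (r : ℝ) (i : Fin n) : Prop :=
  ∀ j, |x i - r| ≤ |x j - r|

open Classical in
/-- Net payoff to player `i` for the target `r`: everybody antes `1` and the `k` winners share
the pot of `n` equally. -/
def payoffAt {n : ℕ} (x : Fin n → ℝ) (r : ℝ) (i : Fin n) : ℝ :=
  if Wins x r i then (n : ℝ) / (Finset.univ.filter fun j => Wins x r j).card - 1 else -1

/-- The payoff function `A_i(x)`: the expectation of the net payoff for a uniform target in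
`[0,1]`. -/
def payoff {n : ℕ} (i : Fin n) (x : Fin n → ℝ) : ℝ :=
  ∫ r in (0 : ℝ)..1, payoffAt x r i

/-- A mixed strategy: a probability measure carried by `[0,1]`. -/
def IsStrategy (μ : Measure ℝ) : Prop :=
  IsProbabilityMeasure μ ∧ μ (Set.Icc 0 1) = 1

/-- Expected payoff to player `i` when the players guess independently, player `j` with
law `μ j`. -/
def expectedPayoff {n : ℕ} (μ : Fin n → Measure ℝ) (i : Fin n) : ℝ :=
  ∫ x, payoff i x ∂(Measure.pi μ)

/-- Nash equilibrium in mixed strategies. -/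
def IsNashEquilibrium {n : ℕ} (μ : Fin n → Measure ℝ) : Prop :=
  (∀ i, IsStrategy (μ i)) ∧
    ∀ (i : Fin n) (ν : Measure ℝ), IsStrategy ν →
      expectedPayoff (Function.update μ i ν) i ≤ expectedPayoff μ i

/-- The symmetrization of `F` about `1/2`; for a continuous cumulative distribution function this
is the probability that a guess lies within `t/2` of `1/2`. -/
def symmetrization (F : ℝ → ℝ) (t : ℝ) : ℝ :=
  F (1 / 2 + t / 2) - F (1 / 2 - t / 2)

/-- The third-order nonlinear differential equation for the symmetrized strategy, at `t`. -/
def SatisfiesODEAt (f : ℝ → ℝ) (t : ℝ) : Prop :=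
  -18 * f t * deriv f t ^ 4 - 12 * t * deriv f t ^ 5
    + 21 * deriv f t ^ 2 * iteratedDeriv 2 f t
    + 9 * f t ^ 2 * deriv f t ^ 2 * iteratedDeriv 2 f t
    - 9 * f t * iteratedDeriv 2 f t ^ 2
    - 3 * f t ^ 3 * iteratedDeriv 2 f t ^ 2
    + 3 * f t * deriv f t * iteratedDeriv 3 f t
    + f t ^ 3 * deriv f t * iteratedDeriv 3 f t = 0

/-- The printed coefficients of `(2x-1)`, `(2x-1)^3`, ..., `(2x-1)^15`. -/
def printedCoeff : Fin 8 → ℝ :=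
  ![0.636459, 0.214848, 0.144471, 0.123155, 0.118372, 0.122339, 0.132742, 0.149142]

end

end ClosestWins

/-! Against an atomless law ties are null, so a guess x earns 4w - 1, where w = `winProb` integrates
over the target r the cube of the chance that one opponent is farther from r than x. Such a law is
an equilibrium of value 0 as soon as 4w = 1 on its support and 4w ≤ 1 on the rest of [0,1].

Indifference is nonlinear in F but linear in its inverse. With t = 2x - 1 and g = 2F - 1 it becomes
an integral equation for the quantile function t = T(g) with a cubic kernel. Repeated integration by
parts reduces it to `quantFun_identity` for S, where T = `quantScale` * S, and a leftover constant
fixes the scale. Comparing coefficients gives a two-step recursion for S with ratios at most 1/3 in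
absolute value, so the series converges beyond |g| ≤ 1, where moreover S' > 0. Hence T can be
inverted, and its inverse defines F (`quantile_integral_equation`, `winProb_eq_of_mem_support`). Off
the support w is affine and falls with the distance to it (`winProb_le`).

Three derivatives of `quantFun_identity` give a linear equation for S (`quantFun_ode`); the rule for
derivatives of an inverse function turns it into the nonlinear equation for the symmetrized F.

The expansion of F must converge up to the ends of the support, so S needs a holomorphic inverse on
a disc of radius above S(1) ≈ 0.8274. On |z| ≤ 11/10, S is close to z / (1 + 5z²/24), and the
resulting fixed-point map is a contraction whenever |τ| ≤ 21/25 (`exists_quantFun_eq`). The Taylor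
coefficients up to degree 15 are certified by exact composition of truncated series, and a rational
enclosure of the scale gives the decimals. -/

namespace ClosestWins

open MeasureTheory

noncomputable section

/-! ### Payoffs against independent opponents with a common atomless law -/

open Classical in
lemma card_wins_eq_sum {n : ℕ} (x : Fin n → ℝ) (r : ℝ) :
    ((Finset.univ.filter fun j => Wins x r j).card : ℝ) = ∑ j, if Wins x r j then (1 : ℝ) else 0 := by
  simp

lemma measurableSet_wins {n : ℕ} (i : Fin n) :
    MeasurableSet {p : (Fin n → ℝ) × ℝ | Wins p.1 p.2 i} := by
  have : {p : (Fin n → ℝ) × ℝ | Wins p.1 p.2 i} = ⋂ j, {p | |p.1 i - p.2| ≤ |p.1 j - p.2|} := by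
    ext p; simp [Wins]
  rw [this]
  exact MeasurableSet.iInter fun j => (isClosed_le (by fun_prop) (by fun_prop)).measurableSet

lemma measurable_payoffAt {n : ℕ} (i : Fin n) :
    Measurable fun p : (Fin n → ℝ) × ℝ => payoffAt p.1 p.2 i := by
  unfold payoffAt
  simp only [card_wins_eq_sum]
  refine Measurable.ite (measurableSet_wins i) ?_ measurable_const
  refine Measurable.sub_const (measurable_const.div ?_) _
  exact Finset.measurable_sum _ fun j _ =>
    Measurable.ite (measurableSet_wins j) measurable_const measurable_const

lemma abs_payoffAt_le {n : ℕ} (x : Fin n → ℝ) (r : ℝ) (i : Fin n) : |payoffAt x r i| ≤ n + 1 := by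
  classical
  unfold payoffAt
  split_ifs with h
  · have hc : (1 : ℝ) ≤ (Finset.univ.filter fun j => Wins x r j).card := by
      exact_mod_cast Finset.card_pos.2 ⟨i, by simpa using h⟩
    have h1 : (n : ℝ) / (Finset.univ.filter fun j => Wins x r j).card ≤ n :=
      div_le_self (by positivity) hc
    have h0 : 0 ≤ (n : ℝ) / (Finset.univ.filter fun j => Wins x r j).card := by positivity
    rw [abs_le]; constructor <;> linarith
  · simp

/-- Off the ties, a player collects the whole pot exactly when strictly closer than all others. -/
lemma payoffAt_insertNth {n : ℕ} (i : Fin (n + 1)) (x r : ℝ) (y : Fin n → ℝ)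
    (hy : ∀ j, |y j - r| ≠ |x - r|) :
    payoffAt (i.insertNth x y : Fin (n + 1) → ℝ) r i =
      (Set.univ.pi fun _ : Fin n => {s : ℝ | |x - r| < |s - r|}).indicator
        (fun _ => (n : ℝ) + 1) y - 1 := by
  classical
  have hw : Wins (i.insertNth x y : Fin (n + 1) → ℝ) r i ↔ ∀ j, |x - r| < |y j - r| := by
    simp only [Wins, i.forall_iff_succAbove, Fin.insertNth_apply_same,
      Fin.insertNth_apply_succAbove, le_refl, true_and]
    exact forall_congr' fun j => ⟨fun h => lt_of_le_of_ne h (hy j).symm, le_of_lt⟩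
  unfold payoffAt
  by_cases h : ∀ j, |x - r| < |y j - r|
  · rw [if_pos (hw.2 h), Set.indicator_of_mem (by simpa [Set.mem_pi] using h)]
    have : (Finset.univ.filter fun j => Wins (i.insertNth x y : Fin (n + 1) → ℝ) r j) = {i} := by
      ext j
      simp only [Finset.mem_filter, Finset.mem_univ, true_and, Finset.mem_singleton]
      refine ⟨fun hj => ?_, fun hj => hj ▸ hw.2 h⟩
      by_contra hne
      obtain ⟨k, rfl⟩ := Fin.exists_succAbove_eq hne
      have := hj i
      simp only [Fin.insertNth_apply_same, Fin.insertNth_apply_succAbove] at this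
      exact absurd (h k) (not_lt.2 this)
    rw [this]; simp
  · rw [if_neg (fun hh => h (hw.1 hh)), Set.indicator_of_notMem (by simpa [Set.mem_pi] using h)]
    simp

/-- Only r + d and r - d can lie at distance d from r, and an atomless law does not charge them.
This is what makes the rule for sharing the pot irrelevant. -/
lemma ae_abs_sub_ne {n : ℕ} (μ : Measure ℝ) [IsProbabilityMeasure μ] [NullSingletonClass μ] (r d : ℝ) :
    ∀ᵐ y ∂(Measure.pi fun _ : Fin n => μ), ∀ j, |y j - r| ≠ d := by
  rw [ae_all_iff]
  intro j
  have h0 : ∀ᵐ s ∂μ, |s - r| ≠ d := by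
    have hsub : {s : ℝ | ¬ |s - r| ≠ d} ⊆ {r + d, r - d} := by
      intro s hs
      simp only [ne_eq, not_not, Set.mem_ofPred_eq] at hs
      rcases abs_choice (s - r) with h | h
      · left; linarith
      · right
        show s = r - d
        linarith
    exact measure_mono_null hsub ((Set.toFinite _).measure_zero μ)
  exact (measurePreserving_eval (fun _ : Fin n => μ) j).quasiMeasurePreserving.ae h0

/-- Winning alone means that all opponents fall in the same set, a box whose product measure is an
n-th power. -/
lemma integral_payoffAt {n : ℕ} (i : Fin (n + 1)) (μ : Measure ℝ) [IsProbabilityMeasure μ]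
    [NullSingletonClass μ] (x r : ℝ) :
    ∫ y, payoffAt (i.insertNth x y : Fin (n + 1) → ℝ) r i ∂(Measure.pi fun _ : Fin n => μ) =
      (n + 1) * μ.real {s : ℝ | |x - r| < |s - r|} ^ n - 1 := by
  have hm : MeasurableSet {s : ℝ | |x - r| < |s - r|} :=
    (isOpen_lt (by fun_prop) (by fun_prop)).measurableSet
  have hm' : MeasurableSet (Set.univ.pi fun _ : Fin n => {s : ℝ | |x - r| < |s - r|}) :=
    MeasurableSet.univ_pi fun _ => hm
  rw [integral_congr_ae ((ae_abs_sub_ne μ r |x - r|).mono fun y hy =>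
    payoffAt_insertNth i x r y hy)]
  rw [integral_sub (by exact (integrable_const _).indicator hm') (integrable_const _),
    integral_indicator_const _ hm']
  simp [measureReal_def, Measure.pi_pi, mul_comm]

/-- The winning probability of the guess `x` against `n` independent opponents of law `μ`. -/
def winProb (n : ℕ) (μ : Measure ℝ) (x : ℝ) : ℝ :=
  ∫ r in (0 : ℝ)..1, μ.real {s : ℝ | |x - r| < |s - r|} ^ n

lemma measurable_insertNth {n : ℕ} (i : Fin (n + 1)) :
    Measurable fun p : ℝ × (Fin n → ℝ) => (i.insertNth p.1 p.2 : Fin (n + 1) → ℝ) :=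
  (MeasurableEquiv.piFinSuccAbove (fun _ => ℝ) i).symm.measurable

lemma integral_payoff {n : ℕ} (i : Fin (n + 1)) (μ : Measure ℝ) [IsProbabilityMeasure μ]
    [NullSingletonClass μ] (x : ℝ) :
    ∫ y, payoff i (i.insertNth x y : Fin (n + 1) → ℝ) ∂(Measure.pi fun _ : Fin n => μ) =
      (n + 1) * winProb n μ x - 1 := by
  have hmeas : Measurable fun p : (Fin n → ℝ) × ℝ =>
      payoffAt (i.insertNth x p.1 : Fin (n + 1) → ℝ) p.2 i :=
    (measurable_payoffAt i).comp
      (((measurable_insertNth i).comp (measurable_const.prodMk measurable_fst)).prodMk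
        measurable_snd)
  have hint : Integrable (fun p : (Fin n → ℝ) × ℝ =>
      payoffAt (i.insertNth x p.1 : Fin (n + 1) → ℝ) p.2 i)
      ((Measure.pi fun _ : Fin n => μ).prod (volume.restrict (Set.Ioc (0 : ℝ) 1))) :=
    Integrable.of_bound hmeas.aestronglyMeasurable _
      (Filter.Eventually.of_forall fun p => abs_payoffAt_le _ _ _)
  have hswap := integral_integral_swap
    (f := fun (y : Fin n → ℝ) (r : ℝ) => payoffAt (i.insertNth x y : Fin (n + 1) → ℝ) r i) hint
  simp only [payoff, winProb, intervalIntegral.integral_of_le (zero_le_one (α := ℝ))]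
  rw [hswap]
  simp only [integral_payoffAt]
  -- Integrability in r of the power of the measure is read off from Fubini instead of being proved
  -- directly.
  have hint2 : Integrable (fun r => ((n : ℝ) + 1) * μ.real {s : ℝ | |x - r| < |s - r|} ^ n - 1)
      (volume.restrict (Set.Ioc (0 : ℝ) 1)) := by
    have := hint.integral_prod_right
    simpa only [integral_payoffAt] using this
  have hint3 : Integrable (fun r => ((n : ℝ) + 1) * μ.real {s : ℝ | |x - r| < |s - r|} ^ n)
      (volume.restrict (Set.Ioc (0 : ℝ) 1)) := by
    exact (hint2.add (integrable_const (1 : ℝ))).congr (.of_forall fun r => by simp)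
  rw [integral_sub hint3 (integrable_const _), integral_const_mul]
  simp

/-- A player's expected payoff against opponents who all use the atomless law `μ`. -/
theorem expectedPayoff_update {n : ℕ} (i : Fin (n + 1)) (μ ν : Measure ℝ) [IsProbabilityMeasure μ]
    [NullSingletonClass μ] [IsProbabilityMeasure ν] :
    expectedPayoff (Function.update (fun _ => μ) i ν) i =
      ∫ x, ((n + 1) * winProb n μ x - 1) ∂ν := by
  have hp : ∀ j, IsProbabilityMeasure (Function.update (fun _ : Fin (n + 1) => μ) i ν j) := by
    intro j
    by_cases h : j = i
    · subst h; simpa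
    · simpa [Function.update_of_ne h]
  have hpay : Measurable fun x : Fin (n + 1) → ℝ => payoff i x := by
    have := ((measurable_payoffAt i).stronglyMeasurable.integral_prod_right'
      (ν := volume.restrict (Set.Ioc (0 : ℝ) 1))).measurable
    simpa only [payoff, intervalIntegral.integral_of_le (zero_le_one (α := ℝ))] using this
  have hbd : ∀ x : Fin (n + 1) → ℝ, ‖payoff i x‖ ≤ (((n + 1 : ℕ) : ℝ) + 1) * |1 - 0| := fun x =>
    intervalIntegral.norm_integral_le_of_norm_le_const fun r _ => abs_payoffAt_le _ _ _
  unfold expectedPayoff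
  rw [← ((measurePreserving_piFinSuccAbove
    (Function.update (fun _ : Fin (n + 1) => μ) i ν) i).symm).integral_comp']
  have he : (Measure.pi fun j => Function.update (fun _ : Fin (n + 1) => μ) i ν (i.succAbove j)) =
      Measure.pi fun _ : Fin n => μ := by
    congr 1; ext1 j; exact Function.update_of_ne (Fin.succAbove_ne i j) _ _
  rw [he, Function.update_self, integral_prod]
  · exact integral_congr_ae (Filter.Eventually.of_forall fun x => integral_payoff i μ x)
  · exact Integrable.of_bound (hpay.comp (measurable_insertNth i)).aestronglyMeasurable _
      (Filter.Eventually.of_forall fun p => hbd _)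

/-- An atomless law whose winning probability is maximal and equal to the fair share `1 / (n + 1)`
almost everywhere yields a symmetric equilibrium of value `0`. -/
theorem isNashEquilibrium_of_winProb {n : ℕ} (μ : Measure ℝ) [IsProbabilityMeasure μ] [NullSingletonClass μ]
    (hμ : μ (Set.Icc 0 1) = 1)
    (hle : ∀ x ∈ Set.Icc (0 : ℝ) 1, (n + 1) * winProb n μ x ≤ 1)
    (heq : ∀ᵐ x ∂μ, (n + 1) * winProb n μ x = 1) :
    IsNashEquilibrium (fun _ : Fin (n + 1) => μ) ∧
      ∀ i, expectedPayoff (fun _ : Fin (n + 1) => μ) i = 0 := by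
  have hz : ∀ i, expectedPayoff (fun _ : Fin (n + 1) => μ) i = 0 := by
    intro i
    have := expectedPayoff_update i μ μ
    rw [show Function.update (fun _ : Fin (n + 1) => μ) i μ = fun _ => μ from
      Function.update_eq_self i _] at this
    rw [this]
    exact integral_eq_zero_of_ae (heq.mono fun x hx => by simp [hx])
  refine ⟨⟨fun _ => ⟨inferInstance, hμ⟩, fun i ν hν => ?_⟩, hz⟩
  have := hν.1
  rw [hz i, expectedPayoff_update i μ ν]
  refine integral_nonpos_of_ae ?_
  have hae : ∀ᵐ x ∂ν, x ∈ Set.Icc (0 : ℝ) 1 := (mem_ae_iff_prob_eq_one measurableSet_Icc).2 hν.2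
  filter_upwards [hae] with x hx
  have := hle x hx
  simp only [Pi.zero_apply]; linarith

/-! ### Power series with geometrically bounded coefficients -/

/-- The sum of the power series with real coefficients `a`, over `ℝ` or `ℂ`. -/
def powSum {𝕜 : Type*} [RCLike 𝕜] (a : ℕ → ℝ) (z : 𝕜) : 𝕜 := ∑' n, (a n : 𝕜) * z ^ n

/-- The coefficients `a` grow at most like a polynomial times `θ ^ n`. -/
def PolyGeomBounded (θ : ℝ) (a : ℕ → ℝ) : Prop :=
  ∃ C : ℝ, ∃ k : ℕ, ∀ n : ℕ, |a n| ≤ C * (n + 1) ^ k * θ ^ n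

/-- Coefficients of the derivative of a power series. -/
def derivCoeff (a : ℕ → ℝ) (n : ℕ) : ℝ := (n + 1) * a (n + 1)

/-- Coefficients of the primitive of a power series that vanishes at `0`. -/
def primCoeff (a : ℕ → ℝ) : ℕ → ℝ
  | 0 => 0
  | n + 1 => a n / (n + 1)

/-- Coefficients of a power series multiplied by the variable. -/
def shiftCoeff (a : ℕ → ℝ) : ℕ → ℝ
  | 0 => 0
  | n + 1 => a n

lemma derivCoeff_primCoeff (a : ℕ → ℝ) : derivCoeff (primCoeff a) = a := by
  ext n
  have : (n : ℝ) + 1 ≠ 0 := by positivity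
  simp [derivCoeff, primCoeff]
  field_simp

section Bounds

variable {θ : ℝ} {a : ℕ → ℝ}

/-- Differentiation multiplies by n + 1, which the polynomial factor absorbs by raising k; the rate
θ is unchanged, so derivatives of every order stay in the class. -/
lemma PolyGeomBounded.derivCoeff (hθ : 0 < θ) (ha : PolyGeomBounded θ a) :
    PolyGeomBounded θ (derivCoeff a) := by
  obtain ⟨C, k, h⟩ := ha
  have hC : 0 ≤ C := by simpa using (abs_nonneg _).trans (h 0)
  refine ⟨C * 2 ^ k * θ, k + 1, fun n => ?_⟩
  have h1 := h (n + 1)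
  have h2 : ((n : ℝ) + 1 + 1) ^ k ≤ (2 * (n + 1)) ^ k := by
    gcongr
    have : (0 : ℝ) ≤ n := n.cast_nonneg
    linarith
  push_cast at h1
  rw [ClosestWins.derivCoeff, abs_mul, abs_of_nonneg (by positivity : (0 : ℝ) ≤ n + 1)]
  calc ((n : ℝ) + 1) * |a (n + 1)| ≤ (n + 1) * (C * (2 * (n + 1)) ^ k * θ ^ (n + 1)) := by
        gcongr
        refine h1.trans ?_
        gcongr
    _ = _ := by rw [mul_pow]; ring

lemma PolyGeomBounded.primCoeff (hθ : 0 < θ) (ha : PolyGeomBounded θ a) :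
    PolyGeomBounded θ (primCoeff a) := by
  obtain ⟨C, k, h⟩ := ha
  have hC : 0 ≤ C := by simpa using (abs_nonneg _).trans (h 0)
  refine ⟨C / θ, k, fun n => ?_⟩
  cases n with
  | zero => simp [ClosestWins.primCoeff]; positivity
  | succ n =>
    rw [ClosestWins.primCoeff, abs_div, abs_of_nonneg (by positivity : (0 : ℝ) ≤ n + 1)]
    calc |a n| / ((n : ℝ) + 1) ≤ |a n| := div_le_self (abs_nonneg _) (by
            have : (0 : ℝ) ≤ n := n.cast_nonneg
            linarith)
      _ ≤ C * (n + 1) ^ k * θ ^ n := h n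
      _ ≤ C * (n + 1 + 1) ^ k * θ ^ n := by gcongr; linarith
      _ = _ := by push_cast; field_simp; ring

lemma PolyGeomBounded.shiftCoeff (hθ : 0 < θ) (ha : PolyGeomBounded θ a) :
    PolyGeomBounded θ (shiftCoeff a) := by
  obtain ⟨C, k, h⟩ := ha
  have hC : 0 ≤ C := by simpa using (abs_nonneg _).trans (h 0)
  refine ⟨C / θ, k, fun n => ?_⟩
  cases n with
  | zero => simp [ClosestWins.shiftCoeff]; positivity
  | succ n =>
    rw [ClosestWins.shiftCoeff]
    calc |a n| ≤ C * (n + 1) ^ k * θ ^ n := h n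
      _ ≤ C * (n + 1 + 1) ^ k * θ ^ n := by gcongr; linarith
      _ = _ := by push_cast; field_simp; ring

lemma PolyGeomBounded.summable_abs (hθ : 0 < θ) (ha : PolyGeomBounded θ a) {R : ℝ} (hR : 0 ≤ R)
    (hRθ : R * θ < 1) : Summable fun n => |a n| * R ^ n := by
  obtain ⟨C, k, h⟩ := ha
  have hC : 0 ≤ C := by simpa using (abs_nonneg _).trans (h 0)
  have hs := summable_pow_mul_geometric_of_norm_lt_one (R := ℝ) k (r := R * θ)
    (by rw [Real.norm_of_nonneg (by positivity)]; exact hRθ)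
  have hs1 := summable_geometric_of_lt_one (r := R * θ) (by positivity) hRθ
  refine Summable.of_nonneg_of_le (fun n => by positivity) (fun n => ?_)
    (((hs.add hs1).mul_left (C * 2 ^ k)))
  have h2 : ((n : ℝ) + 1) ^ k ≤ 2 ^ k * ((n : ℝ) ^ k + 1) := by
    rcases Nat.eq_zero_or_pos n with rfl | hn
    · have : (1 : ℝ) ≤ 2 ^ k := one_le_pow₀ (by norm_num)
      simp only [Nat.cast_zero, zero_add, one_pow]
      have : (0 : ℝ) ≤ 0 ^ k := by positivity
      nlinarith
    · have : (1 : ℝ) ≤ n := by exact_mod_cast hn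
      calc ((n : ℝ) + 1) ^ k ≤ (2 * n) ^ k := by gcongr; linarith
        _ = 2 ^ k * (n : ℝ) ^ k := mul_pow _ _ _
        _ ≤ _ := by gcongr; linarith
  calc |a n| * R ^ n ≤ (C * (n + 1) ^ k * θ ^ n) * R ^ n := by gcongr; exact h n
    _ ≤ (C * (2 ^ k * ((n : ℝ) ^ k + 1)) * θ ^ n) * R ^ n := by gcongr
    _ = _ := by rw [mul_pow]; ring

variable {𝕜 : Type*} [RCLike 𝕜]

lemma PolyGeomBounded.hasSum (hθ : 0 < θ) (ha : PolyGeomBounded θ a) {z : 𝕜} (hz : ‖z‖ * θ < 1) :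
    HasSum (fun n => (a n : 𝕜) * z ^ n) (powSum a z) := by
  refine Summable.hasSum (Summable.of_norm ?_)
  simpa [norm_mul, norm_pow] using ha.summable_abs hθ (norm_nonneg z) hz

/-- Termwise differentiation: the differentiated terms are dominated on a ball of radius R with ‖z‖
< R < 1/θ. -/
lemma PolyGeomBounded.hasDerivAt (hθ : 0 < θ) (ha : PolyGeomBounded θ a) {z : 𝕜}
    (hz : ‖z‖ * θ < 1) :
    HasDerivAt (powSum a : 𝕜 → 𝕜) (powSum (ClosestWins.derivCoeff a) z) z := by
  obtain ⟨R, hzR, hRθ⟩ : ∃ R, ‖z‖ < R ∧ R * θ < 1 := by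
    obtain ⟨R, h1, h2⟩ := exists_between ((lt_div_iff₀ hθ).2 hz)
    exact ⟨R, h1, (lt_div_iff₀ hθ).1 h2⟩
  have hR : 0 < R := (norm_nonneg z).trans_lt hzR
  have hsum := (ha.derivCoeff hθ).summable_abs hθ hR.le hRθ
  have hu : Summable fun n => |a n| * n * R ^ (n - 1) := by
    rw [← summable_nat_add_iff 1]
    refine hsum.congr fun n => ?_
    rw [ClosestWins.derivCoeff, abs_mul, abs_of_nonneg (by positivity : (0 : ℝ) ≤ n + 1)]
    push_cast
    ring
  have hbd : ∀ (n : ℕ) (y : 𝕜), y ∈ Metric.ball (0 : 𝕜) R →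
      ‖(a n : 𝕜) * (n * y ^ (n - 1))‖ ≤ |a n| * n * R ^ (n - 1) := by
    intro n y hy
    rw [mem_ball_zero_iff] at hy
    rw [norm_mul, norm_mul, norm_pow, RCLike.norm_ofReal, RCLike.norm_natCast, ← mul_assoc]
    gcongr
  have key := hasDerivAt_tsum_of_isPreconnected (𝕜 := 𝕜) (g := fun n y => (a n : 𝕜) * y ^ n)
    (g' := fun n y => (a n : 𝕜) * (n * y ^ (n - 1))) (y₀ := 0) (y := z) hu Metric.isOpen_ball
    (convex_ball (0 : 𝕜) R).isPreconnected
    (fun n y _ => (hasDerivAt_pow n y).const_mul _) hbd (Metric.mem_ball_self hR)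
    (ha.hasSum hθ (by simp)).summable (by simpa using hzR)
  convert! key using 1
  have hs' : Summable fun n => (a n : 𝕜) * (n * z ^ (n - 1)) :=
    Summable.of_norm_bounded hu fun n => hbd n z (by simpa using hzR)
  rw [hs'.tsum_eq_zero_add]
  simp only [powSum, ClosestWins.derivCoeff]
  simp
  exact tsum_congr fun n => by ring

lemma PolyGeomBounded.hasDerivAt_primCoeff (hθ : 0 < θ) (ha : PolyGeomBounded θ a) {z : 𝕜}
    (hz : ‖z‖ * θ < 1) :
    HasDerivAt (powSum (ClosestWins.primCoeff a) : 𝕜 → 𝕜) (powSum a z) z := by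
  simpa only [derivCoeff_primCoeff] using (ha.primCoeff hθ).hasDerivAt hθ hz

lemma PolyGeomBounded.powSum_shiftCoeff (hθ : 0 < θ) (ha : PolyGeomBounded θ a) {z : 𝕜}
    (hz : ‖z‖ * θ < 1) : powSum (ClosestWins.shiftCoeff a) z = z * powSum a z := by
  have h := ((ha.shiftCoeff hθ).hasSum hθ hz).summable.tsum_eq_zero_add
  rw [powSum, h, powSum, ← tsum_mul_left]
  simp only [ClosestWins.shiftCoeff, RCLike.ofReal_zero, zero_mul, zero_add]
  exact tsum_congr fun n => by ring

lemma powSum_zero (a : ℕ → ℝ) : powSum a (0 : 𝕜) = (a 0 : 𝕜) := by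
  rw [powSum, tsum_eq_single 0]
  · simp
  · intro n hn; simp [hn]

lemma powSum_neg {ε : ℝ} (h : ∀ n, (-1) ^ n * a n = ε * a n) (z : 𝕜) :
    powSum a (-z) = (ε : 𝕜) * powSum a z := by
  rw [powSum, powSum, ← tsum_mul_left]
  refine tsum_congr fun n => ?_
  have : ((-1) ^ n * a n : 𝕜) = ε * a n := by exact_mod_cast congrArg ((↑) : ℝ → 𝕜) (h n)
  rw [neg_pow, ← mul_assoc, ← mul_assoc, ← this]; ring

lemma primCoeff_parity {ε : ℝ} (h : ∀ n, (-1) ^ n * a n = ε * a n) (n : ℕ) :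
    (-1) ^ n * primCoeff a n = -ε * primCoeff a n := by
  cases n with
  | zero => simp [primCoeff]
  | succ n =>
    simp only [primCoeff, pow_succ]
    have := h n
    field_simp
    linarith

lemma powSum_ofReal (a : ℕ → ℝ) (x : ℝ) : powSum a (x : ℂ) = ((powSum a x : ℝ) : ℂ) := by
  simp [powSum, Complex.ofReal_tsum]

end Bounds

/-- The error of a partial sum whose remaining terms are geometrically bounded. -/
lemma norm_sub_sum_range_le {E : Type*} [NormedAddCommGroup E] [CompleteSpace E] {f : ℕ → E} {s : E}
    (hf : HasSum f s) (N : ℕ) {A r : ℝ} (hr0 : 0 ≤ r) (hr1 : r < 1)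
    (h : ∀ j, ‖f (N + j)‖ ≤ A * r ^ j) :
    ‖s - ∑ n ∈ Finset.range N, f n‖ ≤ A / (1 - r) := by
  have h1 := hf.summable.sum_add_tsum_nat_add N
  rw [hf.tsum_eq] at h1
  rw [← h1, add_sub_cancel_left, div_eq_mul_inv]
  refine tsum_of_norm_bounded ((hasSum_geometric_of_lt_one hr0 hr1).mul_left A) fun j => ?_
  rw [add_comm]; exact h j

/-! ### The quantile series and its functional and differential equations -/

/-- Taylor coefficients of the normalized quantile function. -/
def quantCoeff : ℕ → ℝ
  | 0 => 0
  | 1 => 1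
  | n + 2 => -(((n : ℝ) ^ 3 + 6 * n ^ 2 + 11 * n + 12) / (3 * (n + 2) * (n + 1) * (n + 7))) *
      quantCoeff n

/-- This is the vanishing of the coefficient of g^(n+3) in `powSum_quantCoeff_identity`, cleared of
denominators. -/
lemma quantCoeff_rec (n : ℕ) :
    3 * ((n : ℝ) + 2) * (n + 1) * (n + 7) * quantCoeff (n + 2) =
      -((n : ℝ) ^ 3 + 6 * n ^ 2 + 11 * n + 12) * quantCoeff n := by
  have : (0 : ℝ) ≤ n := n.cast_nonneg
  rw [quantCoeff]
  field_simp

lemma abs_quantCoeff_add_two_le {n : ℕ} : |quantCoeff (n + 2)| ≤ 1 / 3 * |quantCoeff n| := by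
  have : (0 : ℝ) ≤ n := n.cast_nonneg
  rw [quantCoeff, abs_mul, abs_neg, abs_of_nonneg (by positivity)]
  refine mul_le_mul_of_nonneg_right ?_ (abs_nonneg _)
  rw [div_le_div_iff₀ (by positivity) (by norm_num)]
  nlinarith [mul_nonneg this this]

/-- Since 1/3 < (3/5)², the rational rate 3/5 can replace 1/√3. The recursion has step two, hence
two starting values. -/
lemma abs_quantCoeff_add_le (N : ℕ) {A : ℝ} (h0 : |quantCoeff N| ≤ A)
    (h1 : |quantCoeff (N + 1)| ≤ A * (3 / 5)) (j : ℕ) :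
    |quantCoeff (N + j)| ≤ A * (3 / 5) ^ j := by
  have hA : 0 ≤ A := (abs_nonneg _).trans h0
  induction j using Nat.strong_induction_on with
  | _ j ih =>
    match j with
    | 0 => simpa using h0
    | 1 => simpa using h1
    | j + 2 =>
      have := ih j (by omega)
      calc |quantCoeff (N + (j + 2))| ≤ 1 / 3 * |quantCoeff (N + j)| := abs_quantCoeff_add_two_le
        _ ≤ 1 / 3 * (A * (3 / 5) ^ j) := by gcongr
        _ ≤ (3 / 5) ^ 2 * (A * (3 / 5) ^ j) := by gcongr; norm_num
        _ = _ := by ring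

lemma quantCoeff_polyGeomBounded : PolyGeomBounded (3 / 5) quantCoeff := by
  refine ⟨5 / 3, 0, fun n => ?_⟩
  simpa using abs_quantCoeff_add_le 0 (A := 5 / 3) (by norm_num [quantCoeff]) (by simp [quantCoeff]) n

lemma quantCoeff_parity (n : ℕ) : (-1) ^ n * quantCoeff n = -1 * quantCoeff n := by
  induction n using Nat.strong_induction_on with
  | _ n ih =>
    match n with
    | 0 => simp [quantCoeff]
    | 1 => simp [quantCoeff]
    | n + 2 =>
      have := ih n (by omega)
      rw [quantCoeff, pow_add]
      linear_combination (-(((n : ℝ) ^ 3 + 6 * n ^ 2 + 11 * n + 12) /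
        (3 * (n + 2) * (n + 1) * (n + 7)))) * this

/-- The power series form of the integral equation. -/
theorem powSum_quantCoeff_identity {g : ℝ} (hg : |g| * (3 / 5) < 1) :
    3 * powSum (primCoeff quantCoeff) g +
      3 / 2 * powSum (primCoeff (primCoeff (primCoeff quantCoeff))) g +
      (3 * g + g ^ 3) / 4 * powSum quantCoeff g = 9 / 4 * g ^ 2 := by
  have hθ : (0 : ℝ) < 3 / 5 := by norm_num
  have ha := quantCoeff_polyGeomBounded
  have hg' : ‖g‖ * (3 / 5) < 1 := hg
  have h1 := (ha.primCoeff hθ).hasSum hθ hg'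
  have h2 := (((ha.primCoeff hθ).primCoeff hθ).primCoeff hθ).hasSum hθ hg'
  have hs1 := ha.shiftCoeff hθ
  have hs2 := hs1.shiftCoeff hθ
  have hs3 := hs2.shiftCoeff hθ
  have h3 := hs1.hasSum hθ hg'
  have h4 := hs3.hasSum hθ hg'
  rw [ha.powSum_shiftCoeff hθ hg'] at h3
  rw [hs2.powSum_shiftCoeff hθ hg', hs1.powSum_shiftCoeff hθ hg',
    ha.powSum_shiftCoeff hθ hg'] at h4
  have h := (((h1.mul_left 3).add (h2.mul_left (3 / 2))).add (h3.mul_left (3 / 4))).add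
    (h4.mul_left (1 / 4))
  -- The right side is a power series with the single index 2, so the identity is checked
  -- coefficient by coefficient.
  have h' : HasSum (fun n : ℕ => if n = 2 then 9 / 4 * g ^ 2 else 0) (9 / 4 * g ^ 2) :=
    hasSum_ite_eq 2 _
  have := h.unique (h'.congr_fun fun n => ?_)
  · linear_combination this
  match n with
  | 0 => simp [primCoeff, shiftCoeff]
  | 1 => simp [primCoeff, shiftCoeff, quantCoeff]
  | 2 => simp [primCoeff, shiftCoeff, quantCoeff]; ring
  | m + 3 =>
    simp only [primCoeff, shiftCoeff, RCLike.ofReal_real_eq_id, id]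
    rw [if_neg (by omega)]
    have hm : (0 : ℝ) ≤ m := m.cast_nonneg
    have hr := quantCoeff_rec m
    push_cast
    have : quantCoeff (m + 2) = -((m : ℝ) ^ 3 + 6 * m ^ 2 + 11 * m + 12) /
        (3 * (m + 2) * (m + 1) * (m + 7)) * quantCoeff m := by
      field_simp
      linear_combination hr
    rw [this]
    field_simp
    ring

/-- The normalized quantile function (slope `1` at `0`), over `ℝ` or `ℂ`. -/
def quantFun {𝕜 : Type*} [RCLike 𝕜] (z : 𝕜) : 𝕜 := powSum quantCoeff z

/-- The derivative of `quantFun`. -/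
def quantDeriv {𝕜 : Type*} [RCLike 𝕜] (z : 𝕜) : 𝕜 := powSum (derivCoeff quantCoeff) z

/-- The second derivative of `quantFun`. -/
def quantDeriv₂ (g : ℝ) : ℝ := powSum (derivCoeff (derivCoeff quantCoeff)) g

/-- The third derivative of `quantFun`. -/
def quantDeriv₃ (g : ℝ) : ℝ := powSum (derivCoeff (derivCoeff (derivCoeff quantCoeff))) g

/-- The primitive of `quantFun` vanishing at `0`. -/
def quantPrim (g : ℝ) : ℝ := powSum (primCoeff quantCoeff) g

/-- The second primitive of `quantFun`. -/
def quantPrim₂ (g : ℝ) : ℝ := powSum (primCoeff (primCoeff quantCoeff)) g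

/-- The third primitive of `quantFun`. -/
def quantPrim₃ (g : ℝ) : ℝ := powSum (primCoeff (primCoeff (primCoeff quantCoeff))) g

lemma hasDerivAt_quantFun {𝕜 : Type*} [RCLike 𝕜] {z : 𝕜} (hz : ‖z‖ * (3 / 5) < 1) :
    HasDerivAt quantFun (quantDeriv z) z :=
  quantCoeff_polyGeomBounded.hasDerivAt (by norm_num) hz

section RealDerivatives

variable {g : ℝ}

lemma hasDerivAt_quantDeriv (hg : |g| * (3 / 5) < 1) :
    HasDerivAt quantDeriv (quantDeriv₂ g) g :=
  (quantCoeff_polyGeomBounded.derivCoeff (by norm_num)).hasDerivAt (by norm_num) hg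

lemma hasDerivAt_quantDeriv₂ (hg : |g| * (3 / 5) < 1) :
    HasDerivAt quantDeriv₂ (quantDeriv₃ g) g :=
  ((quantCoeff_polyGeomBounded.derivCoeff (by norm_num)).derivCoeff (by norm_num)).hasDerivAt
    (by norm_num) hg

lemma hasDerivAt_quantPrim (hg : |g| * (3 / 5) < 1) :
    HasDerivAt quantPrim (quantFun g) g :=
  quantCoeff_polyGeomBounded.hasDerivAt_primCoeff (by norm_num) hg

lemma hasDerivAt_quantPrim₂ (hg : |g| * (3 / 5) < 1) :
    HasDerivAt quantPrim₂ (quantPrim g) g :=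
  (quantCoeff_polyGeomBounded.primCoeff (by norm_num)).hasDerivAt_primCoeff (by norm_num) hg

lemma hasDerivAt_quantPrim₃ (hg : |g| * (3 / 5) < 1) :
    HasDerivAt quantPrim₃ (quantPrim₂ g) g :=
  ((quantCoeff_polyGeomBounded.primCoeff (by norm_num)).primCoeff
    (by norm_num)).hasDerivAt_primCoeff (by norm_num) hg

end RealDerivatives

lemma quantFun_neg {𝕜 : Type*} [RCLike 𝕜] (z : 𝕜) : quantFun (-z) = -quantFun z := by
  simpa [quantFun] using powSum_neg quantCoeff_parity z

lemma quantPrim_neg (g : ℝ) : quantPrim (-g) = quantPrim g := by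
  simpa [quantPrim] using powSum_neg (primCoeff_parity quantCoeff_parity) g

lemma quantPrim₂_neg (g : ℝ) : quantPrim₂ (-g) = -quantPrim₂ g := by
  simpa [quantPrim₂] using powSum_neg (primCoeff_parity (primCoeff_parity quantCoeff_parity)) g

lemma quantPrim₃_neg (g : ℝ) : quantPrim₃ (-g) = quantPrim₃ g := by
  simpa [quantPrim₃] using
    powSum_neg (primCoeff_parity (primCoeff_parity (primCoeff_parity quantCoeff_parity))) g

lemma quantFun_identity {g : ℝ} (hg : |g| * (3 / 5) < 1) :
    3 * quantPrim g + 3 / 2 * quantPrim₃ g + (3 * g + g ^ 3) / 4 * quantFun g = 9 / 4 * g ^ 2 :=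
  powSum_quantCoeff_identity hg

lemma isOpen_abs_mul_lt : IsOpen {g : ℝ | |g| * (3 / 5) < 1} :=
  isOpen_lt (by fun_prop) (by fun_prop)

lemma deriv_eq_zero_of_forall_eq_zero {f : ℝ → ℝ} {f' g : ℝ} (hg : |g| * (3 / 5) < 1)
    (hf : ∀ h : ℝ, |h| * (3 / 5) < 1 → f h = 0) (hd : HasDerivAt f f' g) : f' = 0 := by
  have he : f =ᶠ[nhds g] fun _ => 0 := by
    filter_upwards [isOpen_abs_mul_lt.mem_nhds hg] with h hh using hf h hh
  exact hd.unique ((hasDerivAt_const g (0 : ℝ)).congr_of_eventuallyEq he)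

/-- The linear differential equation satisfied by the normalized quantile function. -/
theorem quantFun_ode {g : ℝ} (hg : |g| * (3 / 5) < 1) :
    (3 * g + g ^ 3) * quantDeriv₃ g + (21 + 9 * g ^ 2) * quantDeriv₂ g + 18 * g * quantDeriv g +
      12 * quantFun g = 0 := by
  -- `h1`, `h2` and `h3` are the first three derivatives of `quantFun_identity`; the third no longer
  -- contains primitives.
  have h1 : ∀ h : ℝ, |h| * (3 / 5) < 1 →
      3 * quantFun h + 3 / 2 * quantPrim₂ h + (3 + 3 * h ^ 2) / 4 * quantFun h +
        (3 * h + h ^ 3) / 4 * quantDeriv h - 9 / 2 * h = 0 := by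
    intro h hh
    refine deriv_eq_zero_of_forall_eq_zero hh
      (fun k hk => sub_eq_zero.2 (quantFun_identity hk)) ?_
    have hp := ((((hasDerivAt_id h).const_mul 3).add (hasDerivAt_pow 3 h)).div_const 4)
    have := ((((hasDerivAt_quantPrim hh).const_mul 3).add
      ((hasDerivAt_quantPrim₃ hh).const_mul (3 / 2))).add
      (hp.mul (hasDerivAt_quantFun (𝕜 := ℝ) hh))).sub ((hasDerivAt_pow 2 h).const_mul (9 / 4))
    convert! this using 1
    simp; ring
  have h2 : ∀ h : ℝ, |h| * (3 / 5) < 1 →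
      3 * quantDeriv h + 3 / 2 * quantPrim h + 3 / 2 * h * quantFun h +
        (3 + 3 * h ^ 2) / 2 * quantDeriv h + (3 * h + h ^ 3) / 4 * quantDeriv₂ h - 9 / 2 = 0 := by
    intro h hh
    refine deriv_eq_zero_of_forall_eq_zero hh h1 ?_
    have hp := ((((hasDerivAt_id h).const_mul 3).add (hasDerivAt_pow 3 h)).div_const 4)
    have hp' := (((hasDerivAt_pow 2 h).const_mul 3).const_add 3).div_const 4
    have := (((((hasDerivAt_quantFun (𝕜 := ℝ) hh).const_mul 3).add
      ((hasDerivAt_quantPrim₂ hh).const_mul (3 / 2))).add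
      (hp'.mul (hasDerivAt_quantFun (𝕜 := ℝ) hh))).add
      (hp.mul (hasDerivAt_quantDeriv hh))).sub ((hasDerivAt_id h).const_mul (9 / 2))
    convert! this using 1
    simp; ring
  have h3 : 3 * quantDeriv₂ g + 3 / 2 * quantFun g + (3 / 2 * quantFun g + 3 / 2 * g * quantDeriv g)
      + (3 * g * quantDeriv g + (3 + 3 * g ^ 2) / 2 * quantDeriv₂ g) +
      ((3 + 3 * g ^ 2) / 4 * quantDeriv₂ g + (3 * g + g ^ 3) / 4 * quantDeriv₃ g) = 0 := by
    refine deriv_eq_zero_of_forall_eq_zero hg h2 ?_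
    have hp := ((((hasDerivAt_id g).const_mul 3).add (hasDerivAt_pow 3 g)).div_const 4)
    have hp' := (((hasDerivAt_pow 2 g).const_mul 3).const_add 3).div_const 2
    have := (((((hasDerivAt_quantDeriv hg).const_mul 3).add
      ((hasDerivAt_quantPrim hg).const_mul (3 / 2))).add
      (((hasDerivAt_id g).const_mul (3 / 2)).mul (hasDerivAt_quantFun (𝕜 := ℝ) hg))).add
      (hp'.mul (hasDerivAt_quantDeriv hg))).add
      (hp.mul (hasDerivAt_quantDeriv₂ hg)) |>.sub_const (9 / 2)
    convert! this using 1
    simp [-mul_eq_mul_left_iff, -mul_eq_mul_right_iff]; ring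
  linear_combination 4 * h3

/-- Integrate `quantFun_identity` over [0,1]. By parts, the bracket in `hd` is a primitive of (3h +
h³) S + 6 P₃, with S = `quantFun` and P₃ = `quantPrim₃`. The relation handles the boundary terms at
1 in the integral equation. -/
lemma quantPrim_one_identity :
    quantPrim 1 + 3 / 2 * quantPrim₂ 1 + 3 / 2 * quantPrim₃ 1 = 3 / 4 := by
  have hsub : ∀ h ∈ Set.Icc (0 : ℝ) 1, |h| * (3 / 5) < 1 := by
    intro h hh
    rw [abs_of_nonneg hh.1]
    linarith [hh.2]
  have hd : ∀ h ∈ Set.Icc (0 : ℝ) 1, HasDerivAt (fun h : ℝ => 3 * quantPrim₂ h +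
      1 / 4 * ((3 * h + h ^ 3) * quantPrim h - (3 + 3 * h ^ 2) * quantPrim₂ h +
        6 * h * quantPrim₃ h) - 3 / 4 * h ^ 3) 0 h := by
    intro h hh
    have hh' := hsub h hh
    have hp := (((hasDerivAt_id h).const_mul 3).add (hasDerivAt_pow 3 h))
    have hp' := (((hasDerivAt_pow 2 h).const_mul 3).const_add 3)
    have := (((hasDerivAt_quantPrim₂ hh').const_mul 3).add
      ((((hp.mul (hasDerivAt_quantPrim hh')).sub (hp'.mul (hasDerivAt_quantPrim₂ hh'))).add
        (((hasDerivAt_id h).const_mul 6).mul (hasDerivAt_quantPrim₃ hh'))).const_mul (1 / 4))).sub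
      ((hasDerivAt_pow 3 h).const_mul (3 / 4))
    convert! this using 1
    have := quantFun_identity hh'
    simp
    linear_combination -this
  have hc := constant_of_has_deriv_right_zero
    (fun h hh => (hd h hh).continuousAt.continuousWithinAt)
    (fun h hh => (hd h ⟨hh.1, hh.2.le⟩).hasDerivWithinAt) 1 (by simp)
  have h2 : quantPrim₂ 0 = 0 := by rw [quantPrim₂, powSum_zero]; simp [primCoeff]
  simp only [h2] at hc
  norm_num at hc
  linarith

/-- The derivative turns the ratio bound 1/3 into (n + 3) / (3(n + 1)), which is at most (16/25)²
from n = 8 on. -/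
lemma derivCoeff_quantCoeff_abs_le {n : ℕ} (hn : 8 ≤ n) :
    |derivCoeff quantCoeff (n + 2)| ≤ (16 / 25) ^ 2 * |derivCoeff quantCoeff n| := by
  have hn' : (8 : ℝ) ≤ n := by exact_mod_cast hn
  have h := abs_quantCoeff_add_two_le (n := n + 1)
  simp only [derivCoeff, abs_mul]
  push_cast
  rw [abs_of_nonneg (by positivity : (0 : ℝ) ≤ n + 2 + 1),
    abs_of_nonneg (by positivity : (0 : ℝ) ≤ n + 1), show n + 2 + 1 = n + 1 + 2 by ring]
  have h0 := abs_nonneg (quantCoeff (n + 1))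
  calc ((n : ℝ) + 2 + 1) * |quantCoeff (n + 1 + 2)|
      ≤ (n + 2 + 1) * (1 / 3 * |quantCoeff (n + 1)|) := by gcongr
    _ ≤ _ := by nlinarith

lemma abs_derivCoeff_quantCoeff_add_le {N : ℕ} (hN : 8 ≤ N) {A : ℝ}
    (h0 : |derivCoeff quantCoeff N| ≤ A)
    (h1 : |derivCoeff quantCoeff (N + 1)| ≤ A * (16 / 25)) (j : ℕ) :
    |derivCoeff quantCoeff (N + j)| ≤ A * (16 / 25) ^ j := by
  induction j using Nat.strong_induction_on with
  | _ j ih =>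
    match j with
    | 0 => simpa using h0
    | 1 => simpa using h1
    | j + 2 =>
      have := ih j (by omega)
      calc |derivCoeff quantCoeff (N + (j + 2))|
          ≤ (16 / 25) ^ 2 * |derivCoeff quantCoeff (N + j)| :=
            derivCoeff_quantCoeff_abs_le (hN.trans (Nat.le_add_right N j))
        _ ≤ (16 / 25) ^ 2 * (A * (16 / 25) ^ j) := by gcongr
        _ = _ := by ring

lemma quantDeriv_hasSum {𝕜 : Type*} [RCLike 𝕜] {z : 𝕜} (hz : ‖z‖ * (3 / 5) < 1) :
    HasSum (fun n => (derivCoeff quantCoeff n : 𝕜) * z ^ n) (quantDeriv z) :=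
  (quantCoeff_polyGeomBounded.derivCoeff (by norm_num)).hasSum (by norm_num) hz

lemma quantFun_hasSum {𝕜 : Type*} [RCLike 𝕜] {z : 𝕜} (hz : ‖z‖ * (3 / 5) < 1) :
    HasSum (fun n => (quantCoeff n : 𝕜) * z ^ n) (quantFun z) :=
  quantCoeff_polyGeomBounded.hasSum (by norm_num) hz

/-- The partial sum is 1 - 5g²/8 + 7g⁴/32 - 133g⁶/1920; the g⁴ term is dropped and g² ≤ 1 used in
the others. The tail is at most (1/40) / (9/25) = 5/72. -/
lemma quantDeriv_lower {g : ℝ} (hg : |g| ≤ 1) : 1 / 5 ≤ quantDeriv g := by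
  have h := norm_sub_sum_range_le (quantDeriv_hasSum (𝕜 := ℝ) (z := g) (by
      rw [Real.norm_eq_abs]; linarith)) 8 (A := 1 / 40) (r := 16 / 25) (by norm_num) (by norm_num)
    (fun j => by
      have := abs_derivCoeff_quantCoeff_add_le (N := 8) (by norm_num) (A := 1 / 40)
        (by norm_num [derivCoeff, quantCoeff, abs_le]) (by norm_num [derivCoeff, quantCoeff]) j
      rw [norm_mul, norm_pow, RCLike.norm_ofReal, Real.norm_eq_abs]
      calc _ ≤ |derivCoeff quantCoeff (8 + j)| * 1 := by
            gcongr
            exact pow_le_one₀ (abs_nonneg _) hg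
        _ ≤ _ := by rw [mul_one]; exact this)
  rw [Real.norm_eq_abs, abs_le] at h
  have h1 := h.1
  simp [Finset.sum_range_succ, derivCoeff, quantCoeff] at h1
  norm_num at h1
  have hw : g ^ 2 ≤ 1 := by rw [← sq_abs]; exact pow_le_one₀ (abs_nonneg _) hg
  have hw2 : g ^ 6 ≤ 1 := by
    rw [show g ^ 6 = (g ^ 2) ^ 3 by ring]; exact pow_le_one₀ (sq_nonneg _) hw
  have hw3 : 0 ≤ g ^ 4 := by positivity
  linarith

/-! ### The scale, the integral equation and numerical enclosures -/

/-- The slope at the median of the quantile function in symmetric coordinates. -/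
def quantScale : ℝ := 2 / (3 - quantPrim 1)

/-- The right endpoint of the support in symmetric coordinates. -/
def halfWidth : ℝ := quantScale * quantFun (1 : ℝ)

lemma continuousOn_quantDeriv : ContinuousOn (quantDeriv : ℝ → ℝ) (Set.Icc (-1) 1) := fun g hg =>
  (hasDerivAt_quantDeriv (by
    have := abs_le.2 hg
    linarith)).continuousAt.continuousWithinAt

/-- The integral equation for the equilibrium quantile function. -/
theorem quantile_integral_equation (hs : quantPrim 1 < 3) {g : ℝ} (hg : g ∈ Set.Icc (-1 : ℝ) 1) :
    quantScale * ((∫ h in g..1, (1 + (g - h) / 2) ^ 3 * quantDeriv h) +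
        ∫ h in (-1)..g, (1 - (g - h) / 2) ^ 3 * quantDeriv h) +
      (2 - quantScale * quantFun g - halfWidth) * ((1 + g) / 2) ^ 3 +
      (2 + quantScale * quantFun g - halfWidth) * ((1 - g) / 2) ^ 3 = 1 := by
  have hsub : ∀ h ∈ Set.Icc (-1 : ℝ) 1, |h| * (3 / 5) < 1 := by
    intro h hh
    have := abs_le.2 hh
    linarith
  have h1 : ∫ h in g..1, (1 + (g - h) / 2) ^ 3 * quantDeriv h =
      (((1 + g) / 2) ^ 3 * quantFun 1 + 3 / 2 * ((1 + g) / 2) ^ 2 * quantPrim 1 +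
        3 / 2 * ((1 + g) / 2) * quantPrim₂ 1 + 3 / 4 * quantPrim₃ 1) -
      (quantFun g + 3 / 2 * quantPrim g + 3 / 2 * quantPrim₂ g + 3 / 4 * quantPrim₃ g) := by
    have hss : Set.uIcc g 1 ⊆ Set.Icc (-1) 1 := by
      rw [Set.uIcc_of_le hg.2]; exact Set.Icc_subset_Icc_left hg.1
    -- The primitive comes from repeated integration by parts, each step differentiating the cubic
    -- and integrating S once more.
    rw [intervalIntegral.integral_eq_sub_of_hasDerivAt (f := fun h : ℝ =>
      (1 + (g - h) / 2) ^ 3 * quantFun h + 3 / 2 * (1 + (g - h) / 2) ^ 2 * quantPrim h +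
        3 / 2 * (1 + (g - h) / 2) * quantPrim₂ h + 3 / 4 * quantPrim₃ h)]
    · ring_nf
    · intro h hh
      have hh' := hsub h (hss hh)
      have hX : HasDerivAt (fun h : ℝ => 1 + (g - h) / 2) (-1 / 2) h := by
        simpa using (((hasDerivAt_id h).const_sub g).div_const 2).const_add 1
      have := (((hX.pow 3).mul (hasDerivAt_quantFun (𝕜 := ℝ) hh')).add
        (((hX.pow 2).const_mul (3 / 2)).mul (hasDerivAt_quantPrim hh'))).add
        ((hX.const_mul (3 / 2)).mul (hasDerivAt_quantPrim₂ hh')) |>.add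
        ((hasDerivAt_quantPrim₃ hh').const_mul (3 / 4))
      convert! this using 1
      simp; ring
    · exact (ContinuousOn.mul (by fun_prop) (continuousOn_quantDeriv.mono hss)).intervalIntegrable
  have h2 : ∫ h in (-1)..g, (1 - (g - h) / 2) ^ 3 * quantDeriv h =
      (quantFun g - 3 / 2 * quantPrim g + 3 / 2 * quantPrim₂ g - 3 / 4 * quantPrim₃ g) -
      (-((1 - g) / 2) ^ 3 * quantFun 1 - 3 / 2 * ((1 - g) / 2) ^ 2 * quantPrim 1 -
        3 / 2 * ((1 - g) / 2) * quantPrim₂ 1 - 3 / 4 * quantPrim₃ 1) := by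
    have hss : Set.uIcc (-1) g ⊆ Set.Icc (-1) 1 := by
      rw [Set.uIcc_of_le hg.1]; exact Set.Icc_subset_Icc_right hg.2
    rw [intervalIntegral.integral_eq_sub_of_hasDerivAt (f := fun h : ℝ =>
      (1 - (g - h) / 2) ^ 3 * quantFun h - 3 / 2 * (1 - (g - h) / 2) ^ 2 * quantPrim h +
        3 / 2 * (1 - (g - h) / 2) * quantPrim₂ h - 3 / 4 * quantPrim₃ h)]
    · simp only [quantFun_neg, quantPrim_neg, quantPrim₂_neg, quantPrim₃_neg]
      ring_nf
    · intro h hh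
      have hh' := hsub h (hss hh)
      have hX : HasDerivAt (fun h : ℝ => 1 - (g - h) / 2) (1 / 2) h := by
        have := (((hasDerivAt_id h).const_sub g).div_const 2).const_sub 1
        convert! this using 1
        norm_num
      have := (((hX.pow 3).mul (hasDerivAt_quantFun (𝕜 := ℝ) hh')).sub
        (((hX.pow 2).const_mul (3 / 2)).mul (hasDerivAt_quantPrim hh'))).add
        ((hX.const_mul (3 / 2)).mul (hasDerivAt_quantPrim₂ hh')) |>.sub
        ((hasDerivAt_quantPrim₃ hh').const_mul (3 / 4))
      convert! this using 1
      simp; ring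
    · exact (ContinuousOn.mul (by fun_prop) (continuousOn_quantDeriv.mono hss)).intervalIntegrable
  have h3 := quantFun_identity (hsub g hg)
  have h4 := quantPrim_one_identity
  -- This normalization is the reason for the value of `quantScale`: after `h3` and `h4` only a
  -- multiple of it remains, and the terms with `halfWidth` cancel those with S(1).
  have h5 : quantScale * (3 - quantPrim 1) = 2 := div_mul_cancel₀ _ (by linarith)
  rw [h1, h2, halfWidth]
  linear_combination (-quantScale) * h3 + (quantScale) * h4 + (1 / 4 - 3 * g ^ 2 / 4) * h5

/-- The coefficient of index 30 vanishes by parity, so the constant only has to cover index 31.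
Summing the tail gives an error of 8/10⁹. -/
lemma abs_quantCoeff_thirty_add_le (j : ℕ) :
    |quantCoeff (30 + j)| ≤ 32 / 10 ^ 10 * (3 / 5) ^ j :=
  abs_quantCoeff_add_le 30 (by norm_num [quantCoeff]) (by norm_num [quantCoeff, abs_le]) j

lemma quantFun_one_bounds :
    0.82742249 ≤ quantFun (1 : ℝ) ∧ quantFun (1 : ℝ) ≤ 0.82742252 := by
  have h := norm_sub_sum_range_le (quantFun_hasSum (𝕜 := ℝ) (z := 1) (by norm_num)) 30
    (r := 3 / 5) (by norm_num) (by norm_num) (fun j => by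
      simpa using abs_quantCoeff_thirty_add_le j)
  rw [Real.norm_eq_abs, abs_le] at h
  simp [Finset.sum_range_succ, quantCoeff] at h
  norm_num at h
  constructor <;> linarith [h.1, h.2]

lemma quantPrim_one_bounds : 0.45416819 ≤ quantPrim 1 ∧ quantPrim 1 ≤ 0.45416822 := by
  have h := norm_sub_sum_range_le ((quantCoeff_polyGeomBounded.primCoeff (by norm_num)).hasSum
    (𝕜 := ℝ) (z := 1) (by norm_num) (by norm_num)) 31
    (r := 3 / 5) (by norm_num) (by norm_num) (fun j => by
      have h1 := abs_quantCoeff_thirty_add_le j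
      have h2 : |primCoeff quantCoeff (31 + j)| ≤ |quantCoeff (30 + j)| := by
        rw [show 31 + j = (30 + j) + 1 by ring, primCoeff, abs_div]
        refine div_le_self (abs_nonneg _) ?_
        rw [abs_of_nonneg (by positivity)]
        have : (0 : ℝ) ≤ ((30 + j : ℕ) : ℝ) := Nat.cast_nonneg _
        linarith
      simpa using h2.trans h1)
  rw [Real.norm_eq_abs, abs_le] at h
  change _ ≤ quantPrim 1 - _ ∧ quantPrim 1 - _ ≤ _ at h
  simp [Finset.sum_range_succ, primCoeff, quantCoeff] at h
  norm_num at h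
  constructor <;> linarith [h.1, h.2]

lemma quantScale_bounds : 0.78559785 ≤ quantScale ∧ quantScale ≤ 0.78559787 := by
  obtain ⟨h1, h2⟩ := quantPrim_one_bounds
  have h3 : (0 : ℝ) < 3 - quantPrim 1 := by linarith
  rw [quantScale, le_div_iff₀ h3, div_le_iff₀ h3]
  constructor <;> nlinarith

lemma quantScale_pos : 0 < quantScale := by linarith [quantScale_bounds.1]

lemma halfWidth_bounds : 0.6500212 ≤ halfWidth ∧ halfWidth ≤ 0.6500215 := by
  obtain ⟨h1, h2⟩ := quantScale_bounds
  obtain ⟨h3, h4⟩ := quantFun_one_bounds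
  rw [halfWidth]
  constructor <;> nlinarith

/-! ### The quantile function and its inverse -/

/-- The equilibrium quantile function in the coordinates `t = 2 * x - 1`, `g = 2 * F x - 1`. -/
def quantile (g : ℝ) : ℝ := quantScale * quantFun g

lemma hasDerivAt_quantile {g : ℝ} (hg : |g| * (3 / 5) < 1) :
    HasDerivAt quantile (quantScale * quantDeriv g) g :=
  (hasDerivAt_quantFun (𝕜 := ℝ) hg).const_mul quantScale

lemma abs_mul_lt_of_mem_Icc {g : ℝ} (hg : g ∈ Set.Icc (-1 : ℝ) 1) : |g| * (3 / 5) < 1 := by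
  have := abs_le.2 hg
  linarith

lemma quantile_neg (g : ℝ) : quantile (-g) = -quantile g := by
  simp [quantile, quantFun_neg]

lemma quantile_one : quantile 1 = halfWidth := rfl

lemma quantile_neg_one : quantile (-1) = -halfWidth := by rw [quantile_neg, quantile_one]

lemma continuousOn_quantile : ContinuousOn quantile (Set.Icc (-1) 1) := fun _ hg =>
  (hasDerivAt_quantile (abs_mul_lt_of_mem_Icc hg)).continuousAt.continuousWithinAt

/-- Mean value inequality: the slope is at least `quantScale` / 5 > 1/10. It yields both injectivity
and a Lipschitz bound for the inverse. -/
lemma quantile_sub_ge {g h : ℝ} (hg : g ∈ Set.Icc (-1 : ℝ) 1) (hh : h ∈ Set.Icc (-1 : ℝ) 1)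
    (hgh : g ≤ h) : 1 / 10 * (h - g) ≤ quantile h - quantile g := by
  refine (convex_Icc (-1 : ℝ) 1).mul_sub_le_image_sub_of_le_deriv continuousOn_quantile
    (fun x hx => ?_) (fun x hx => ?_) g hg h hh hgh
  · exact (hasDerivAt_quantile
      (abs_mul_lt_of_mem_Icc (interior_subset hx))).differentiableAt.differentiableWithinAt
  · rw [(hasDerivAt_quantile (abs_mul_lt_of_mem_Icc (interior_subset hx))).deriv]
    have hx' : x ∈ Set.Icc (-1 : ℝ) 1 := interior_subset hx
    have := quantDeriv_lower (abs_le.2 hx')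
    nlinarith [quantScale_bounds.1]

lemma strictMonoOn_quantile : StrictMonoOn quantile (Set.Icc (-1) 1) := fun g hg h hh hgh => by
  have := quantile_sub_ge hg hh hgh.le
  linarith

lemma quantile_image : Set.Icc (-halfWidth) halfWidth ⊆ quantile '' Set.Icc (-1) 1 := by
  have := intermediate_value_Icc (by norm_num : (-1 : ℝ) ≤ 1) continuousOn_quantile
  rwa [quantile_neg_one, quantile_one] at this

/-- Truncation of a real number to `[-halfWidth, halfWidth]`. -/
def clampWidth (t : ℝ) : ℝ := max (-halfWidth) (min halfWidth t)

lemma halfWidth_pos : 0 < halfWidth := by linarith [halfWidth_bounds.1]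

lemma clampWidth_mem (t : ℝ) : clampWidth t ∈ Set.Icc (-halfWidth) halfWidth :=
  ⟨le_max_left _ _, max_le (by linarith [halfWidth_pos]) (min_le_left _ _)⟩

lemma clampWidth_of_mem {t : ℝ} (ht : t ∈ Set.Icc (-halfWidth) halfWidth) : clampWidth t = t := by
  rw [clampWidth, min_eq_right ht.2, max_eq_right ht.1]

/-- The inverse of `quantile`, extended by constants. -/
def invQuantile (t : ℝ) : ℝ := Function.invFunOn quantile (Set.Icc (-1) 1) (clampWidth t)

lemma invQuantile_mem (t : ℝ) : invQuantile t ∈ Set.Icc (-1 : ℝ) 1 :=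
  Function.invFunOn_mem (quantile_image (clampWidth_mem t))

lemma quantile_invQuantile (t : ℝ) : quantile (invQuantile t) = clampWidth t :=
  Function.invFunOn_eq (quantile_image (clampWidth_mem t))

lemma quantile_mem {g : ℝ} (hg : g ∈ Set.Icc (-1 : ℝ) 1) :
    quantile g ∈ Set.Icc (-halfWidth) halfWidth := by
  rw [← quantile_neg_one, ← quantile_one]
  exact ⟨strictMonoOn_quantile.monotoneOn (by simp) hg hg.1,
    strictMonoOn_quantile.monotoneOn hg (by simp) hg.2⟩

lemma invQuantile_eq_of_quantile_eq {g t : ℝ} (hg : g ∈ Set.Icc (-1 : ℝ) 1)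
    (h : quantile g = clampWidth t) : invQuantile t = g :=
  strictMonoOn_quantile.injOn (invQuantile_mem t) hg (by rw [quantile_invQuantile, h])

lemma invQuantile_quantile {g : ℝ} (hg : g ∈ Set.Icc (-1 : ℝ) 1) : invQuantile (quantile g) = g :=
  invQuantile_eq_of_quantile_eq hg (clampWidth_of_mem (quantile_mem hg)).symm

lemma invQuantile_of_ge {t : ℝ} (ht : halfWidth ≤ t) : invQuantile t = 1 :=
  invQuantile_eq_of_quantile_eq (by simp) (by
    rw [quantile_one, clampWidth, min_eq_left ht, max_eq_right (by linarith [halfWidth_pos])])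

lemma invQuantile_of_le {t : ℝ} (ht : t ≤ -halfWidth) : invQuantile t = -1 :=
  invQuantile_eq_of_quantile_eq (by simp) (by
    rw [quantile_neg_one, clampWidth, min_eq_right (by linarith [halfWidth_pos]), max_eq_left ht])

lemma clampWidth_neg (t : ℝ) : clampWidth (-t) = -clampWidth t := by
  have := halfWidth_pos
  simp only [clampWidth]
  rcases le_total t (-halfWidth) with h | h
  · rw [min_eq_left (by linarith), max_eq_right (by linarith), min_eq_right (by linarith),
      max_eq_left h, neg_neg]
  · rcases le_total t halfWidth with h' | h'
    · rw [min_eq_right (by linarith), max_eq_right (by linarith), min_eq_right h', max_eq_right h]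
    · rw [min_eq_right (by linarith), max_eq_left (by linarith), min_eq_left h',
        max_eq_right (by linarith)]

lemma invQuantile_neg (t : ℝ) : invQuantile (-t) = -invQuantile t := by
  have h := invQuantile_mem t
  refine invQuantile_eq_of_quantile_eq ⟨by linarith [h.2], by linarith [h.1]⟩ ?_
  rw [quantile_neg, quantile_invQuantile, clampWidth_neg]

lemma monotone_clampWidth : Monotone clampWidth := fun _ _ h =>
  max_le_max le_rfl (min_le_min le_rfl h)

lemma monotone_invQuantile : Monotone invQuantile := fun s t h => by
  rw [← strictMonoOn_quantile.le_iff_le (invQuantile_mem s) (invQuantile_mem t),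
    quantile_invQuantile, quantile_invQuantile]
  exact monotone_clampWidth h

/-- By `quantile_sub_ge` the inverse is 10-Lipschitz in the truncated variable. -/
lemma continuous_invQuantile : Continuous invQuantile := by
  have hc : Continuous clampWidth := by unfold clampWidth; fun_prop
  have key : ∀ s t, |invQuantile s - invQuantile t| ≤ 10 * |clampWidth s - clampWidth t| := by
    intro s t
    wlog hst : s ≤ t generalizing s t
    · rw [abs_sub_comm, abs_sub_comm (clampWidth s)]
      exact this t s (le_of_not_ge hst)
    have h1 := quantile_sub_ge (invQuantile_mem s) (invQuantile_mem t) (monotone_invQuantile hst)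
    rw [quantile_invQuantile, quantile_invQuantile] at h1
    rw [abs_sub_comm, abs_of_nonneg (sub_nonneg.2 (monotone_invQuantile hst)), abs_sub_comm,
      abs_of_nonneg (sub_nonneg.2 (monotone_clampWidth hst))]
    linarith
  rw [continuous_iff_continuousAt]
  intro t
  rw [ContinuousAt, tendsto_iff_dist_tendsto_zero]
  have h0 : Filter.Tendsto (fun s => 10 * |clampWidth s - clampWidth t|) (nhds t) (nhds 0) := by
    have : Continuous fun s => 10 * |clampWidth s - clampWidth t| := by fun_prop
    simpa using this.tendsto t
  exact squeeze_zero (fun _ => dist_nonneg) (fun s => by rw [Real.dist_eq]; exact key s t) h0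

/-! ### The equilibrium law and its support -/

/-- The equilibrium distribution function. -/
def eqCDF : StieltjesFunction ℝ where
  toFun x := (1 + invQuantile (2 * x - 1)) / 2
  mono' x y h := by
    have := monotone_invQuantile (by linarith : 2 * x - 1 ≤ 2 * y - 1)
    show _ / 2 ≤ _ / 2
    linarith
  right_continuous' x := by
    have := continuous_invQuantile
    exact (by fun_prop : Continuous fun x => (1 + invQuantile (2 * x - 1)) / 2).continuousWithinAt

lemma eqCDF_apply (x : ℝ) : eqCDF x = (1 + invQuantile (2 * x - 1)) / 2 := rfl

lemma continuous_eqCDF : Continuous eqCDF := by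
  have := continuous_invQuantile
  exact (by fun_prop : Continuous fun x => (1 + invQuantile (2 * x - 1)) / 2)

/-- The left endpoint of the support. -/
def leftEnd : ℝ := (1 - halfWidth) / 2

/-- The right endpoint of the support. -/
def rightEnd : ℝ := (1 + halfWidth) / 2

lemma eqCDF_of_le {x : ℝ} (hx : x ≤ leftEnd) : eqCDF x = 0 := by
  rw [leftEnd] at hx
  rw [eqCDF_apply, invQuantile_of_le (by linarith)]; norm_num

lemma eqCDF_of_ge {x : ℝ} (hx : rightEnd ≤ x) : eqCDF x = 1 := by
  rw [rightEnd] at hx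
  rw [eqCDF_apply, invQuantile_of_ge (by linarith)]; norm_num

lemma tendsto_eqCDF_atBot : Filter.Tendsto eqCDF Filter.atBot (nhds 0) :=
  tendsto_const_nhds.congr' <| (Filter.eventually_le_atBot leftEnd).mono fun _ hx =>
    (eqCDF_of_le hx).symm

lemma tendsto_eqCDF_atTop : Filter.Tendsto eqCDF Filter.atTop (nhds 1) :=
  tendsto_const_nhds.congr' <| (Filter.eventually_ge_atTop rightEnd).mono fun _ hx =>
    (eqCDF_of_ge hx).symm

/-- The equilibrium strategy. -/
def eqMeasure : Measure ℝ := eqCDF.measure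

instance : IsProbabilityMeasure eqMeasure :=
  eqCDF.isProbabilityMeasure tendsto_eqCDF_atBot tendsto_eqCDF_atTop

lemma leftLim_eqCDF (x : ℝ) : Function.leftLim eqCDF x = eqCDF x :=
  continuous_eqCDF.continuousWithinAt.leftLim_eq

instance : NullSingletonClass eqMeasure :=
  ⟨fun x => by rw [eqMeasure, StieltjesFunction.measure_singleton, leftLim_eqCDF]; simp⟩

lemma cdf_eqMeasure : ProbabilityTheory.cdf eqMeasure = eqCDF :=
  ProbabilityTheory.cdf_measure_stieltjesFunction _ tendsto_eqCDF_atBot tendsto_eqCDF_atTop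

lemma eqMeasure_Icc (a b : ℝ) : eqMeasure (Set.Icc a b) = ENNReal.ofReal (eqCDF b - eqCDF a) := by
  rw [eqMeasure, StieltjesFunction.measure_Icc, leftLim_eqCDF]

lemma leftEnd_le_rightEnd : leftEnd ≤ rightEnd := by
  rw [leftEnd, rightEnd]; linarith [halfWidth_pos]

lemma leftEnd_pos : 0 < leftEnd := by
  rw [leftEnd]; linarith [halfWidth_bounds.2]

lemma rightEnd_lt_one : rightEnd < 1 := by
  rw [rightEnd]; linarith [halfWidth_bounds.2]

lemma eqMeasure_Icc_ends : eqMeasure (Set.Icc leftEnd rightEnd) = 1 := by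
  rw [eqMeasure_Icc, eqCDF_of_le le_rfl, eqCDF_of_ge le_rfl]; simp

lemma eqMeasure_Icc_zero_one : eqMeasure (Set.Icc 0 1) = 1 := by
  rw [eqMeasure_Icc, eqCDF_of_le leftEnd_pos.le, eqCDF_of_ge rightEnd_lt_one.le]; simp

/-- The point of the game interval with symmetric distribution value `g`. -/
def quantilePoint (g : ℝ) : ℝ := (1 + quantile g) / 2

lemma eqCDF_quantilePoint {g : ℝ} (hg : g ∈ Set.Icc (-1 : ℝ) 1) :
    eqCDF (quantilePoint g) = (1 + g) / 2 := by
  rw [eqCDF_apply, quantilePoint, show 2 * ((1 + quantile g) / 2) - 1 = quantile g by ring,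
    invQuantile_quantile hg]

lemma quantilePoint_neg_one : quantilePoint (-1) = leftEnd := by
  rw [quantilePoint, quantile_neg_one, leftEnd]; ring

lemma quantilePoint_one : quantilePoint 1 = rightEnd := by
  rw [quantilePoint, quantile_one, rightEnd]

lemma exists_quantilePoint_eq {x : ℝ} (hx : x ∈ Set.Icc leftEnd rightEnd) :
    ∃ g ∈ Set.Icc (-1 : ℝ) 1, quantilePoint g = x := by
  refine ⟨invQuantile (2 * x - 1), invQuantile_mem _, ?_⟩
  have h1 := hx.1
  have h2 := hx.2
  rw [leftEnd] at h1
  rw [rightEnd] at h2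
  rw [quantilePoint, quantile_invQuantile, clampWidth_of_mem ⟨by linarith, by linarith⟩]; ring

lemma strictMonoOn_eqCDF : StrictMonoOn eqCDF (Set.Icc leftEnd rightEnd) := by
  intro x hx y hy hxy
  obtain ⟨g, hg, rfl⟩ := exists_quantilePoint_eq hx
  obtain ⟨h, hh, rfl⟩ := exists_quantilePoint_eq hy
  rw [eqCDF_quantilePoint hg, eqCDF_quantilePoint hh]
  have : g < h := by
    rw [← strictMonoOn_quantile.lt_iff_lt hg hh]
    rw [quantilePoint, quantilePoint] at hxy
    linarith
  linarith

theorem support_eqMeasure : eqMeasure.support = Set.Icc leftEnd rightEnd := by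
  refine Set.Subset.antisymm ?_ ?_
  · refine Measure.support_subset_of_isClosed isClosed_Icc ?_
    exact (mem_ae_iff_prob_eq_one measurableSet_Icc).2 eqMeasure_Icc_ends
  · intro x hx
    rw [Measure.mem_support_iff_forall]
    intro U hU
    obtain ⟨ε, hε, hsub⟩ := Metric.mem_nhds_iff.1 hU
    have hlt : leftEnd < rightEnd := by rw [leftEnd, rightEnd]; linarith [halfWidth_pos]
    set a := max leftEnd (x - ε / 2) with ha
    set b := min rightEnd (x + ε / 2) with hb
    have hab : a < b := by
      rw [ha, hb, max_lt_iff, lt_min_iff, lt_min_iff]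
      exact ⟨⟨hlt, by linarith [hx.1]⟩, by linarith [hx.2], by linarith⟩
    have hale : leftEnd ≤ a := le_max_left _ _
    have hble : b ≤ rightEnd := min_le_left _ _
    have hsub' : Set.Icc a b ⊆ U := fun y hy => hsub (by
      have h1 : x - ε / 2 ≤ y := (le_max_right _ _).trans hy.1
      have h2 : y ≤ x + ε / 2 := hy.2.trans (min_le_right _ _)
      rw [Metric.mem_ball, Real.dist_eq, abs_lt]
      constructor <;> linarith)
    refine lt_of_lt_of_le ?_ (measure_mono hsub')
    rw [eqMeasure_Icc, ENNReal.ofReal_pos, sub_pos]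
    exact strictMonoOn_eqCDF ⟨hale, hab.le.trans hble⟩ ⟨hale.trans hab.le, hble⟩ hab

/-! ### Winning probabilities and the equilibrium property -/

/-- The points at least as close to r as x form the closed interval between x and its reflection 2r
- x. -/
lemma eqMeasure_real_farther (x r : ℝ) :
    eqMeasure.real {s : ℝ | |x - r| < |s - r|} = 1 - |eqCDF (2 * r - x) - eqCDF x| := by
  have hset : {s : ℝ | |x - r| < |s - r|} = (Set.Icc (r - |x - r|) (r + |x - r|))ᶜ := by
    ext s
    simp only [Set.mem_ofPred_eq, Set.mem_compl_iff, Set.mem_Icc, ← not_le]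
    rw [not_iff_not, abs_le]
    constructor <;> rintro ⟨h1, h2⟩ <;> constructor <;> linarith
  rw [hset, probReal_compl_eq_one_sub measurableSet_Icc, measureReal_def, eqMeasure_Icc]
  congr 1
  rcases le_total x r with h | h
  · have hm := eqCDF.mono (by linarith : x ≤ 2 * r - x)
    rw [abs_of_nonpos (by linarith : x - r ≤ 0), abs_of_nonneg (by linarith),
      show r - -(x - r) = x by ring, show r + -(x - r) = 2 * r - x by ring,
      ENNReal.toReal_ofReal (by linarith)]
  · have hm := eqCDF.mono (by linarith : 2 * r - x ≤ x)
    rw [abs_of_nonneg (by linarith : 0 ≤ x - r), abs_of_nonpos (by linarith),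
      show r - (x - r) = 2 * r - x by ring, show r + (x - r) = x by ring,
      ENNReal.toReal_ofReal (by linarith)]
    ring

/-- Split at r = x to resolve the absolute value, then substitute y = 2r - x; this gives the limits
-x and 2 - x and the factor 1/2. -/
lemma winProb_eqMeasure {x : ℝ} (hx : x ∈ Set.Icc (0 : ℝ) 1) :
    winProb 3 eqMeasure x = 1 / 2 * ((∫ y in (-x)..x, (1 - (eqCDF x - eqCDF y)) ^ 3) +
      ∫ y in x..(2 - x), (1 + (eqCDF x - eqCDF y)) ^ 3) := by
  have hc := continuous_eqCDF
  have hcont : Continuous fun r : ℝ => (1 - |eqCDF (2 * r - x) - eqCDF x|) ^ 3 := by fun_prop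
  simp only [winProb, eqMeasure_real_farther]
  rw [← intervalIntegral.integral_add_adjacent_intervals (hcont.intervalIntegrable 0 x)
    (hcont.intervalIntegrable x 1)]
  have h1 : ∫ r in (0 : ℝ)..x, (1 - |eqCDF (2 * r - x) - eqCDF x|) ^ 3 =
      ∫ r in (0 : ℝ)..x, (fun y => (1 - (eqCDF x - eqCDF y)) ^ 3) (2 * r - x) := by
    refine intervalIntegral.integral_congr fun r hr => ?_
    rw [Set.uIcc_of_le hx.1] at hr
    have hm := eqCDF.mono (by linarith [hr.2] : 2 * r - x ≤ x)
    simp only [abs_of_nonpos (sub_nonpos.2 hm)]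
    ring
  have h2 : ∫ r in x..1, (1 - |eqCDF (2 * r - x) - eqCDF x|) ^ 3 =
      ∫ r in x..1, (fun y => (1 + (eqCDF x - eqCDF y)) ^ 3) (2 * r - x) := by
    refine intervalIntegral.integral_congr fun r hr => ?_
    rw [Set.uIcc_of_le hx.2] at hr
    have hm := eqCDF.mono (by linarith [hr.1] : x ≤ 2 * r - x)
    simp only [abs_of_nonneg (sub_nonneg.2 hm)]
    ring
  rw [h1, h2,
    intervalIntegral.integral_comp_mul_sub (fun y => (1 - (eqCDF x - eqCDF y)) ^ 3) two_ne_zero x,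
    intervalIntegral.integral_comp_mul_sub (fun y => (1 + (eqCDF x - eqCDF y)) ^ 3) two_ne_zero x]
  simp only [smul_eq_mul]
  rw [show (2 : ℝ) * 0 - x = -x by ring, show 2 * x - x = x by ring,
    show (2 : ℝ) * 1 - x = 2 - x by ring]
  ring

/-- Substituting y = `quantilePoint` k makes F the variable of integration, so that the unknown
enters only linearly, through its derivative. -/
lemma integral_comp_eqCDF {φ : ℝ → ℝ} (hφ : Continuous φ) {g h : ℝ}
    (hg : g ∈ Set.Icc (-1 : ℝ) 1) (hh : h ∈ Set.Icc (-1 : ℝ) 1) :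
    ∫ y in (quantilePoint g)..(quantilePoint h), φ (eqCDF y) =
      quantScale / 2 * ∫ k in g..h, φ ((1 + k) / 2) * quantDeriv k := by
  have hss : Set.uIcc g h ⊆ Set.Icc (-1) 1 := Set.uIcc_subset_Icc hg hh
  have hd : ∀ k ∈ Set.uIcc g h,
      HasDerivAt quantilePoint (quantScale * quantDeriv k / 2) k := fun k hk =>
    ((hasDerivAt_quantile (abs_mul_lt_of_mem_Icc (hss hk))).const_add 1).div_const 2
  have hc := continuous_eqCDF
  have := intervalIntegral.integral_comp_mul_deriv (g := fun y => φ (eqCDF y)) hd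
    (((continuousOn_const.mul (continuousOn_quantDeriv.mono hss)).div_const 2)) (by fun_prop)
  rw [← this, ← intervalIntegral.integral_const_mul]
  refine intervalIntegral.integral_congr fun k hk => ?_
  simp only [Function.comp, eqCDF_quantilePoint (hss hk)]
  ring

/-- Against the equilibrium law every guess in its support wins with probability `1 / 4`. -/
theorem winProb_eq_of_mem_support {x : ℝ} (hx : x ∈ Set.Icc leftEnd rightEnd) :
    4 * winProb 3 eqMeasure x = 1 := by
  have hx01 : x ∈ Set.Icc (0 : ℝ) 1 :=
    ⟨leftEnd_pos.le.trans hx.1, hx.2.trans rightEnd_lt_one.le⟩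
  have hc := continuous_eqCDF
  rw [winProb_eqMeasure hx01]
  have hi1 : ∀ a b : ℝ, IntervalIntegrable (fun y => (1 - (eqCDF x - eqCDF y)) ^ 3) volume a b :=
    fun a b => Continuous.intervalIntegrable (by fun_prop) a b
  have hi2 : ∀ a b : ℝ, IntervalIntegrable (fun y => (1 + (eqCDF x - eqCDF y)) ^ 3) volume a b :=
    fun a b => Continuous.intervalIntegrable (by fun_prop) a b
  rw [← intervalIntegral.integral_add_adjacent_intervals (hi1 (-x) leftEnd) (hi1 leftEnd x),
    ← intervalIntegral.integral_add_adjacent_intervals (hi2 x rightEnd) (hi2 rightEnd (2 - x))]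
  obtain ⟨g, hg, rfl⟩ := exists_quantilePoint_eq hx
  have hF := eqCDF_quantilePoint hg
  -- Left of the support F = 0 and right of it F = 1, so these two pieces have constant integrands
  -- and give the boundary terms.
  have e1 : ∫ y in (-quantilePoint g)..leftEnd, (1 - (eqCDF (quantilePoint g) - eqCDF y)) ^ 3 =
      (leftEnd + quantilePoint g) * ((1 - g) / 2) ^ 3 := by
    rw [intervalIntegral.integral_congr (g := fun _ => ((1 - g) / 2) ^ 3)]
    · simp
    · intro y hy
      rw [Set.uIcc_of_le (by linarith [leftEnd_pos, hx01.1])] at hy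
      simp only [hF, eqCDF_of_le hy.2]
      ring
  have e2 : ∫ y in rightEnd..(2 - quantilePoint g), (1 + (eqCDF (quantilePoint g) - eqCDF y)) ^ 3 =
      (2 - quantilePoint g - rightEnd) * ((1 + g) / 2) ^ 3 := by
    rw [intervalIntegral.integral_congr (g := fun _ => ((1 + g) / 2) ^ 3)]
    · simp
    · intro y hy
      rw [Set.uIcc_of_le (by linarith [rightEnd_lt_one, hx01.2])] at hy
      simp only [hF, eqCDF_of_ge hy.1]
      ring
  have e3 := integral_comp_eqCDF (φ := fun p => (1 - ((1 + g) / 2 - p)) ^ 3) (by fun_prop)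
    (by simp : (-1 : ℝ) ∈ Set.Icc (-1 : ℝ) 1) hg
  have e4 := integral_comp_eqCDF (φ := fun p => (1 + ((1 + g) / 2 - p)) ^ 3) (by fun_prop)
    hg (by simp : (1 : ℝ) ∈ Set.Icc (-1 : ℝ) 1)
  rw [quantilePoint_neg_one] at e3
  rw [quantilePoint_one] at e4
  have key := quantile_integral_equation (by linarith [quantPrim_one_bounds.2]) hg
  have e5 : ∀ k : ℝ, (1 + g) / 2 - (1 + k) / 2 = (g - k) / 2 := fun k => by ring
  simp only [e5] at e3 e4
  rw [e1, e2]
  simp only [hF]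
  rw [e3, e4, quantilePoint, leftEnd, rightEnd, quantile]
  linear_combination key

/-- Against the equilibrium law no guess wins with probability above `1 / 4`. -/
theorem winProb_le {x : ℝ} (hx : x ∈ Set.Icc (0 : ℝ) 1) : 4 * winProb 3 eqMeasure x ≤ 1 := by
  have hc := continuous_eqCDF
  have hlr := leftEnd_le_rightEnd
  have hl0 := leftEnd_pos
  have hr1 := rightEnd_lt_one
  rcases le_total leftEnd x with hl | hl
  · rcases le_total x rightEnd with hr | hr
    · exact (winProb_eq_of_mem_support ⟨hl, hr⟩).le
    -- Right of the support the winning probability is affine in z with slope -1/2, so it is at most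
    -- its value at `rightEnd`.
    · have hgen : ∀ z ∈ Set.Icc rightEnd 1, winProb 3 eqMeasure z =
          1 / 2 * ((∫ y in leftEnd..rightEnd, eqCDF y ^ 3) + (z - rightEnd) + (2 - 2 * z)) := by
        intro z hz
        have hi : ∀ a b : ℝ, IntervalIntegrable (fun y => (1 - (1 - eqCDF y)) ^ 3) volume a b :=
          fun a b => Continuous.intervalIntegrable (by fun_prop) a b
        rw [winProb_eqMeasure ⟨by linarith [hz.1], hz.2⟩]
        simp only [eqCDF_of_ge hz.1]
        rw [← intervalIntegral.integral_add_adjacent_intervals (hi (-z) leftEnd) (hi leftEnd z),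
          ← intervalIntegral.integral_add_adjacent_intervals (hi leftEnd rightEnd) (hi rightEnd z)]
        have f1 : ∫ y in (-z)..leftEnd, (1 - (1 - eqCDF y)) ^ 3 = 0 := by
          rw [intervalIntegral.integral_congr (g := fun _ => (0 : ℝ))]
          · simp
          · intro y hy
            rw [Set.uIcc_of_le (by linarith [hz.1])] at hy
            simp [eqCDF_of_le hy.2]
        have f2 : ∫ y in rightEnd..z, (1 - (1 - eqCDF y)) ^ 3 = z - rightEnd := by
          rw [intervalIntegral.integral_congr (g := fun _ => (1 : ℝ))]
          · simp
          · intro y hy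
            rw [Set.uIcc_of_le hz.1] at hy
            simp [eqCDF_of_ge hy.1]
        have f3 : ∫ y in z..(2 - z), (1 + (1 - eqCDF y)) ^ 3 = 2 - 2 * z := by
          rw [intervalIntegral.integral_congr (g := fun _ => (1 : ℝ))]
          · simp; ring
          · intro y hy
            rw [Set.uIcc_of_le (by linarith [hz.2])] at hy
            simp [eqCDF_of_ge (hz.1.trans hy.1)]
        rw [f1, f2, f3]
        simp only [sub_sub_cancel]
        ring
      have h1 := hgen x ⟨hr, hx.2⟩
      have h2 := hgen rightEnd ⟨le_rfl, hr1.le⟩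
      have h3 := winProb_eq_of_mem_support (x := rightEnd) ⟨hlr, le_rfl⟩
      linarith
  -- Left of the support the slope is +1/2.
  · have hgen : ∀ z ∈ Set.Icc 0 leftEnd, winProb 3 eqMeasure z =
        1 / 2 * (2 * z + (leftEnd - z) + ∫ y in leftEnd..rightEnd, (1 - eqCDF y) ^ 3) := by
      intro z hz
      have hi : ∀ a b : ℝ, IntervalIntegrable (fun y => (1 + (0 - eqCDF y)) ^ 3) volume a b :=
        fun a b => Continuous.intervalIntegrable (by fun_prop) a b
      rw [winProb_eqMeasure ⟨hz.1, by linarith [hz.2]⟩]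
      simp only [eqCDF_of_le hz.2]
      rw [← intervalIntegral.integral_add_adjacent_intervals (hi z leftEnd) (hi leftEnd (2 - z)),
        ← intervalIntegral.integral_add_adjacent_intervals (hi leftEnd rightEnd)
          (hi rightEnd (2 - z))]
      have f1 : ∫ y in rightEnd..(2 - z), (1 + (0 - eqCDF y)) ^ 3 = 0 := by
        rw [intervalIntegral.integral_congr (g := fun _ => (0 : ℝ))]
        · simp
        · intro y hy
          rw [Set.uIcc_of_le (by linarith [hz.2])] at hy
          simp [eqCDF_of_ge hy.1]
      have f2 : ∫ y in z..leftEnd, (1 + (0 - eqCDF y)) ^ 3 = leftEnd - z := by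
        rw [intervalIntegral.integral_congr (g := fun _ => (1 : ℝ))]
        · simp
        · intro y hy
          rw [Set.uIcc_of_le hz.2] at hy
          simp [eqCDF_of_le hy.2]
      have f3 : ∫ y in (-z)..z, (1 - (0 - eqCDF y)) ^ 3 = 2 * z := by
        rw [intervalIntegral.integral_congr (g := fun _ => (1 : ℝ))]
        · simp; ring
        · intro y hy
          rw [Set.uIcc_of_le (by linarith [hz.1])] at hy
          simp [eqCDF_of_le (hy.2.trans hz.2)]
      rw [f1, f2, f3]
      simp only [zero_sub, ← sub_eq_add_neg]
      ring
    have h1 := hgen x ⟨hx.1, hl⟩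
    have h2 := hgen leftEnd ⟨hl0.le, le_rfl⟩
    have h3 := winProb_eq_of_mem_support (x := leftEnd) ⟨le_rfl, hlr⟩
    linarith

theorem isNashEquilibrium_eqMeasure :
    IsNashEquilibrium (fun _ : Fin 4 => eqMeasure) ∧
      ∀ i, expectedPayoff (fun _ : Fin 4 => eqMeasure) i = 0 := by
  refine isNashEquilibrium_of_winProb (n := 3) eqMeasure eqMeasure_Icc_zero_one
    (fun x hx => ?_) ?_
  · have := winProb_le hx
    norm_num
    linarith
  · have hae : ∀ᵐ x ∂eqMeasure, x ∈ Set.Icc leftEnd rightEnd :=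
      (mem_ae_iff_prob_eq_one measurableSet_Icc).2 eqMeasure_Icc_ends
    filter_upwards [hae] with x hx
    have := winProb_eq_of_mem_support hx
    norm_num
    linarith

/-! ### The nonlinear differential equation -/

lemma invQuantile_hasDerivAt {t : ℝ} (ht : t ∈ Set.Ioo (-halfWidth) halfWidth) :
    HasDerivAt invQuantile (quantScale * quantDeriv (invQuantile t))⁻¹ t := by
  refine HasDerivAt.of_local_left_inverse continuous_invQuantile.continuousAt
    (hasDerivAt_quantile (abs_mul_lt_of_mem_Icc (invQuantile_mem t))) ?_ ?_
  · have := quantDeriv_lower (abs_le.2 (invQuantile_mem t))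
    have := quantScale_pos
    positivity
  · filter_upwards [isOpen_Ioo.mem_nhds ht] with s hs
    rw [quantile_invQuantile, clampWidth_of_mem ⟨hs.1.le, hs.2.le⟩]

/-- The derivatives of the inverse of T are 1/T', -T''/T'³ and (3T''² - T'T''')/T'⁵. Inserting them,
with t = T(g), turns the equation into a multiple of `quantFun_ode`. -/
theorem invQuantile_satisfiesODEAt {t : ℝ} (ht : t ∈ Set.Ioo (-halfWidth) halfWidth) :
    SatisfiesODEAt invQuantile t := by
  have hs := quantScale_pos
  have hq : ∀ s, 0 < quantDeriv (invQuantile s) := fun s => by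
    linarith [quantDeriv_lower (abs_le.2 (invQuantile_mem s))]
  have hr : ∀ s, |invQuantile s| * (3 / 5) < 1 := fun s =>
    abs_mul_lt_of_mem_Icc (invQuantile_mem s)
  have d1 : ∀ s ∈ Set.Ioo (-halfWidth) halfWidth,
      deriv invQuantile s = (quantScale * quantDeriv (invQuantile s))⁻¹ := fun s h =>
    (invQuantile_hasDerivAt h).deriv
  have d2 : ∀ s ∈ Set.Ioo (-halfWidth) halfWidth, iteratedDeriv 2 invQuantile s =
      -quantDeriv₂ (invQuantile s) / (quantScale ^ 2 * quantDeriv (invQuantile s) ^ 3) := by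
    intro s h
    rw [iteratedDeriv_succ, iteratedDeriv_one]
    have he : deriv invQuantile =ᶠ[nhds s]
        fun u => (quantScale * quantDeriv (invQuantile u))⁻¹ := by
      filter_upwards [isOpen_Ioo.mem_nhds h] with u hu using d1 u hu
    rw [he.deriv_eq]
    have hd := (((hasDerivAt_quantDeriv (hr s)).comp s (invQuantile_hasDerivAt h)).const_mul
      quantScale).inv (mul_pos hs (hq s)).ne'
    refine (HasDerivAt.deriv hd).trans ?_
    have := (hq s).ne'
    simp only [Function.comp]
    field_simp
  have d3 : iteratedDeriv 3 invQuantile t =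
      (3 * quantDeriv₂ (invQuantile t) ^ 2 - quantDeriv (invQuantile t) *
        quantDeriv₃ (invQuantile t)) / (quantScale ^ 3 * quantDeriv (invQuantile t) ^ 5) := by
    rw [iteratedDeriv_succ]
    have he : iteratedDeriv 2 invQuantile =ᶠ[nhds t] fun s =>
        -quantDeriv₂ (invQuantile s) / (quantScale ^ 2 * quantDeriv (invQuantile s) ^ 3) := by
      filter_upwards [isOpen_Ioo.mem_nhds ht] with u hu using d2 u hu
    rw [he.deriv_eq]
    have hd := ((hasDerivAt_quantDeriv₂ (hr t)).comp t (invQuantile_hasDerivAt ht)).neg.div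
      ((((hasDerivAt_quantDeriv (hr t)).comp t (invQuantile_hasDerivAt ht)).pow 3).const_mul
        (quantScale ^ 2)) (mul_pos (pow_pos hs 2) (pow_pos (hq t) 3)).ne'
    refine (HasDerivAt.deriv hd).trans ?_
    have := (hq t).ne'
    simp only [Function.comp, Pi.neg_apply, Pi.pow_apply]
    field_simp
    ring
  have hode := quantFun_ode (hr t)
  have ht' : quantScale * quantFun (invQuantile t) = t := by
    have := quantile_invQuantile t
    rwa [clampWidth_of_mem ⟨ht.1.le, ht.2.le⟩] at this
  rw [SatisfiesODEAt, d1 t ht, d2 t ht, d3]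
  have hq0 := (hq t).ne'
  generalize invQuantile t = g at *
  have hS : quantFun g = t / quantScale := by rw [← ht']; field_simp
  rw [hS] at hode
  field_simp at hode ⊢
  linear_combination (-quantDeriv g) * hode

/-! ### Holomorphic inversion on the disc of radius 21/25 -/

section ComplexInverse

variable {z w τ : ℂ}

/-- On this disc the tail is geometric with ratio (16/25)(11/10) = 88/125. -/
lemma norm_quantDeriv_sub_le (hz : ‖z‖ ≤ 11 / 10) :
    ‖quantDeriv z - ∑ n ∈ Finset.range 14, (derivCoeff quantCoeff n : ℂ) * z ^ n‖ ≤ 41 / 5000 := by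
  have h := norm_sub_sum_range_le (quantDeriv_hasSum (𝕜 := ℂ) (z := z) (by linarith)) 14
    (A := 24 / 10000) (r := 88 / 125) (by norm_num) (by norm_num) (fun j => by
      have h1 := abs_derivCoeff_quantCoeff_add_le (N := 14) (by norm_num) (A := 63 / 100000)
        (by norm_num [derivCoeff, quantCoeff, abs_le]) (by norm_num [derivCoeff, quantCoeff]) j
      rw [norm_mul, norm_pow]
      have h0 : ‖((derivCoeff quantCoeff (14 + j) : ℝ) : ℂ)‖ = |derivCoeff quantCoeff (14 + j)| :=
        RCLike.norm_ofReal _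
      calc ‖((derivCoeff quantCoeff (14 + j) : ℝ) : ℂ)‖ * ‖z‖ ^ (14 + j)
          ≤ (63 / 100000 * (16 / 25) ^ j) * (11 / 10) ^ (14 + j) := by
            gcongr
            exact h0.le.trans h1
        _ = (63 / 100000 * (11 / 10) ^ 14) * (88 / 125) ^ j := by
            rw [pow_add, show (88 / 125 : ℝ) = 16 / 25 * (11 / 10) by norm_num, mul_pow]; ring
        _ ≤ _ := by gcongr; norm_num)
  exact h.trans (by norm_num)

lemma norm_quantFun_sub_le (hz : ‖z‖ ≤ 11 / 10) :
    ‖quantFun z - ∑ n ∈ Finset.range 14, (quantCoeff n : ℂ) * z ^ n‖ ≤ 1 / 1000 := by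
  have h := norm_sub_sum_range_le (quantFun_hasSum (𝕜 := ℂ) (z := z) (by linarith)) 14
    (A := 3 / 10000) (r := 33 / 50) (by norm_num) (by norm_num) (fun j => by
      have h1 := abs_quantCoeff_add_le 14 (A := 7 / 100000)
        (by norm_num [quantCoeff, abs_le]) (by norm_num [quantCoeff, abs_le]) j
      rw [norm_mul, norm_pow]
      have h0 : ‖((quantCoeff (14 + j) : ℝ) : ℂ)‖ = |quantCoeff (14 + j)| :=
        RCLike.norm_ofReal _
      calc ‖((quantCoeff (14 + j) : ℝ) : ℂ)‖ * ‖z‖ ^ (14 + j)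
          ≤ (7 / 100000 * (3 / 5) ^ j) * (11 / 10) ^ (14 + j) := by
            gcongr
            exact h0.le.trans h1
        _ = (7 / 100000 * (11 / 10) ^ 14) * (33 / 50) ^ j := by
            rw [pow_add, show (33 / 50 : ℝ) = 3 / 5 * (11 / 10) by norm_num, mul_pow]; ring
        _ ≤ _ := by gcongr; norm_num)
  exact h.trans (by norm_num)

/-- The deviation of `quantFun` from `z / (1 + 5 / 24 * z ^ 2)`. -/
def quantErr (z : ℂ) : ℂ := quantFun z * (1 + 5 / 24 * z ^ 2) - z

/-- The derivative of `quantErr`. -/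
def quantErrDeriv (z : ℂ) : ℂ :=
  quantDeriv z * (1 + 5 / 24 * z ^ 2) + 5 / 12 * z * quantFun z - 1

lemma hasDerivAt_quantErr (hz : ‖z‖ ≤ 11 / 10) : HasDerivAt quantErr (quantErrDeriv z) z := by
  have h := ((hasDerivAt_quantFun (𝕜 := ℂ) (z := z) (by linarith)).mul
    (((hasDerivAt_pow 2 z).const_mul (5 / 24)).const_add 1)).sub (hasDerivAt_id z)
  convert! h using 1
  rw [quantErrDeriv]
  push_cast
  ring

lemma norm_one_add_sq_le (hz : ‖z‖ ≤ 11 / 10) : ‖1 + 5 / 24 * z ^ 2‖ ≤ 601 / 480 := by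
  have h2 : ‖z‖ ^ 2 ≤ (11 / 10) ^ 2 := by gcongr
  have h3 : ‖(5 / 24 : ℂ) * z ^ 2‖ = 5 / 24 * ‖z‖ ^ 2 := by
    rw [norm_mul, norm_pow]; norm_num
  have := norm_add_le (1 : ℂ) (5 / 24 * z ^ 2)
  rw [h3, norm_one] at this
  linarith

/-- The constant 5/24 cancels the z³ term of `quantErr`, so its derivative starts at z⁴/576. The
explicit terms contribute at most 25/1000, and the two truncation errors fit in the rest. -/
lemma norm_quantErrDeriv_le (hz : ‖z‖ ≤ 11 / 10) : ‖quantErrDeriv z‖ ≤ 1 / 25 := by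
  set P := ∑ n ∈ Finset.range 14, (derivCoeff quantCoeff n : ℂ) * z ^ n with hP
  set Q := ∑ n ∈ Finset.range 14, (quantCoeff n : ℂ) * z ^ n with hQ
  have hpoly : P * (1 + 5 / 24 * z ^ 2) + 5 / 12 * z * Q - 1 =
      1 / 576 * z ^ 4 + (-7 / 1280) * z ^ 6 + 19 / 6720 * z ^ 8 +
        (-259787 / 232243200) * z ^ 10 + 1339481 / 3344302080 * z ^ 12 +
        1296845 / 2675441664 * z ^ 14 := by
    simp [hP, hQ, Finset.sum_range_succ, derivCoeff, quantCoeff]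
    ring
  have hterm : ∀ (c : ℂ) (n : ℕ), ‖c * z ^ n‖ ≤ ‖c‖ * (11 / 10) ^ n := fun c n => by
    rw [norm_mul, norm_pow]; gcongr
  have hpn : ‖P * (1 + 5 / 24 * z ^ 2) + 5 / 12 * z * Q - 1‖ ≤ 25 / 1000 := by
    rw [hpoly]
    have t1 := hterm (1 / 576) 4
    have t2 := hterm (-7 / 1280) 6
    have t3 := hterm (19 / 6720) 8
    have t4 := hterm (-259787 / 232243200) 10
    have t5 := hterm (1339481 / 3344302080) 12
    have t6 := hterm (1296845 / 2675441664) 14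
    refine (norm_add_le _ _).trans ((add_le_add ((norm_add_le _ _).trans (add_le_add
      ((norm_add_le _ _).trans (add_le_add ((norm_add_le _ _).trans (add_le_add
      ((norm_add_le _ _).trans (add_le_add t1 t2)) t3)) t4)) t5)) t6).trans ?_)
    norm_num
  have h1 := norm_quantDeriv_sub_le hz
  have h2 := norm_quantFun_sub_le hz
  have h3 := norm_one_add_sq_le hz
  have hsplit : quantErrDeriv z = (P * (1 + 5 / 24 * z ^ 2) + 5 / 12 * z * Q - 1) +
      (quantDeriv z - P) * (1 + 5 / 24 * z ^ 2) + 5 / 12 * z * (quantFun z - Q) := by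
    rw [quantErrDeriv]; ring
  rw [hsplit]
  refine (norm_add₃_le).trans ?_
  have t1 : ‖(quantDeriv z - P) * (1 + 5 / 24 * z ^ 2)‖ ≤ 41 / 5000 * (601 / 480) := by
    rw [norm_mul]; gcongr
  have t2 : ‖5 / 12 * z * (quantFun z - Q)‖ ≤ 5 / 12 * (11 / 10) * (1 / 1000) := by
    rw [norm_mul, norm_mul, show ‖(5 / 12 : ℂ)‖ = 5 / 12 by norm_num]; gcongr
  linarith

lemma norm_quantErr_sub_le (hz : ‖z‖ ≤ 11 / 10) (hw : ‖w‖ ≤ 11 / 10) :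
    ‖quantErr z - quantErr w‖ ≤ 1 / 25 * ‖z - w‖ :=
  (convex_closedBall (0 : ℂ) (11 / 10)).norm_image_sub_le_of_norm_hasDerivWithin_le
    (fun x hx => (hasDerivAt_quantErr (by simpa using hx)).hasDerivWithinAt)
    (fun x hx => norm_quantErrDeriv_le (by simpa using hx)) (by simpa using hw) (by simpa using hz)

lemma norm_quantErr_le (hz : ‖z‖ ≤ 11 / 10) : ‖quantErr z‖ ≤ 11 / 250 := by
  have h0 : quantErr 0 = 0 := by simp [quantErr, quantFun, powSum_zero, quantCoeff]
  have := norm_quantErr_sub_le hz (w := 0) (by norm_num)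
  rw [h0, sub_zero, sub_zero] at this
  linarith

/-- The map whose fixed points are the preimages of `τ` under `quantFun`. -/
def inverseMap (τ z : ℂ) : ℂ := τ * (1 + 5 / 24 * z ^ 2) - quantErr z

lemma inverseMap_eq (τ z : ℂ) :
    inverseMap τ z = z - (quantFun z - τ) * (1 + 5 / 24 * z ^ 2) := by
  rw [inverseMap, quantErr]; ring

lemma one_add_sq_ne_zero (hz : ‖z‖ ≤ 11 / 10) : (1 + 5 / 24 * z ^ 2 : ℂ) ≠ 0 := by
  intro h
  have h1 : ‖(5 / 24 : ℂ) * z ^ 2‖ = 1 := by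
    rw [show (5 / 24 : ℂ) * z ^ 2 = -1 by linear_combination h]; simp
  rw [norm_mul, norm_pow, show ‖(5 / 24 : ℂ)‖ = 5 / 24 by norm_num] at h1
  have h2 : ‖z‖ ^ 2 ≤ (11 / 10) ^ 2 := by gcongr
  linarith

lemma inverseMap_fixed_iff (hz : ‖z‖ ≤ 11 / 10) : inverseMap τ z = z ↔ quantFun z = τ := by
  rw [inverseMap_eq, sub_eq_self, mul_eq_zero, or_iff_left (one_add_sq_ne_zero hz), sub_eq_zero]

/-- The bound needed is (21/25)(601/480) + 11/250 < 11/10. The radius 21/25 lies just above S(1) and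
is small enough for this estimate. -/
lemma norm_inverseMap_le (hτ : ‖τ‖ ≤ 21 / 25) (hz : ‖z‖ ≤ 11 / 10) :
    ‖inverseMap τ z‖ ≤ 11 / 10 := by
  have h1 : ‖τ * (1 + 5 / 24 * z ^ 2)‖ ≤ 21 / 25 * (601 / 480) := by
    rw [norm_mul]
    have := norm_one_add_sq_le hz
    gcongr
  have := norm_sub_le (τ * (1 + 5 / 24 * z ^ 2)) (quantErr z)
  rw [inverseMap]
  linarith [norm_quantErr_le hz]

/-- The quadratic part has Lipschitz constant (21/25)(5/24)(11/5) = 0.385 and `quantErr` adds 1/25.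
-/
lemma norm_inverseMap_sub_le (hτ : ‖τ‖ ≤ 21 / 25) (hz : ‖z‖ ≤ 11 / 10) (hw : ‖w‖ ≤ 11 / 10) :
    ‖inverseMap τ z - inverseMap τ w‖ ≤ 1 / 2 * ‖z - w‖ := by
  have h1 : inverseMap τ z - inverseMap τ w =
      τ * (5 / 24) * (z + w) * (z - w) - (quantErr z - quantErr w) := by
    rw [inverseMap, inverseMap]; ring
  have h2 : ‖τ * (5 / 24) * (z + w) * (z - w)‖ ≤ 21 / 25 * (5 / 24) * (11 / 5) * ‖z - w‖ := by
    have : ‖z + w‖ ≤ 11 / 5 := (norm_add_le _ _).trans (by linarith)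
    rw [norm_mul, norm_mul, norm_mul, show ‖(5 / 24 : ℂ)‖ = 5 / 24 by norm_num]
    gcongr
  rw [h1]
  have := norm_sub_le (τ * (5 / 24) * (z + w) * (z - w)) (quantErr z - quantErr w)
  linarith [norm_quantErr_sub_le hz hw, norm_nonneg (z - w)]

lemma exists_quantFun_eq (hτ : ‖τ‖ ≤ 21 / 25) : ∃ z : ℂ, ‖z‖ ≤ 11 / 10 ∧ quantFun z = τ := by
  have hmaps : Set.MapsTo (inverseMap τ) (Metric.closedBall 0 (11 / 10))
      (Metric.closedBall 0 (11 / 10)) := fun z hz => by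
    rw [mem_closedBall_zero_iff] at hz ⊢
    exact norm_inverseMap_le hτ hz
  have hcontr : ContractingWith (1 / 2 : NNReal) (hmaps.restrict _ _ _) := by
    refine ⟨by rw [← NNReal.coe_lt_coe]; norm_num, LipschitzWith.of_dist_le_mul fun z w => ?_⟩
    have := norm_inverseMap_sub_le hτ (mem_closedBall_zero_iff.1 z.2)
      (mem_closedBall_zero_iff.1 w.2)
    simpa [Subtype.dist_eq, dist_eq_norm] using this
  obtain ⟨z, hz, hfix, -⟩ := hcontr.exists_fixedPoint' Metric.isClosed_closedBall.isComplete hmaps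
    (Metric.mem_closedBall_self (by norm_num)) (edist_ne_top _ _)
  rw [mem_closedBall_zero_iff] at hz
  exact ⟨z, hz, (inverseMap_fixed_iff hz).1 hfix⟩

/-- A contraction by 1/2 bounds the distance to the fixed point by twice the residual, and 2 ·
601/480 < 3. This gives uniqueness and continuity of the inverse, and the accuracy of approximate
inverses. -/
lemma norm_sub_le_of_quantFun_eq (hτ : ‖τ‖ ≤ 21 / 25) (hz : ‖z‖ ≤ 11 / 10) (hw : ‖w‖ ≤ 11 / 10)
    (hzτ : quantFun z = τ) : ‖z - w‖ ≤ 3 * ‖quantFun w - τ‖ := by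
  have h1 := norm_inverseMap_sub_le hτ hz hw
  rw [(inverseMap_fixed_iff hz).2 hzτ, inverseMap_eq τ w] at h1
  have h2 : ‖(quantFun w - τ) * (1 + 5 / 24 * w ^ 2)‖ ≤ ‖quantFun w - τ‖ * (601 / 480) := by
    rw [norm_mul]
    have := norm_one_add_sq_le hw
    gcongr
  have h3 : ‖z - w‖ ≤ ‖z - (w - (quantFun w - τ) * (1 + 5 / 24 * w ^ 2))‖ +
      ‖(quantFun w - τ) * (1 + 5 / 24 * w ^ 2)‖ := by
    have := norm_sub_le (z - (w - (quantFun w - τ) * (1 + 5 / 24 * w ^ 2)))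
      ((quantFun w - τ) * (1 + 5 / 24 * w ^ 2))
    refine le_trans (le_of_eq ?_) this
    congr 1; ring
  linarith [norm_nonneg (quantFun w - τ)]

open Classical in
/-- The holomorphic inverse of `quantFun` near `0`. -/
def complexInverse (τ : ℂ) : ℂ :=
  if h : ‖τ‖ ≤ 21 / 25 then (exists_quantFun_eq h).choose else 0

lemma norm_complexInverse_le (hτ : ‖τ‖ ≤ 21 / 25) : ‖complexInverse τ‖ ≤ 11 / 10 := by
  rw [complexInverse, dif_pos hτ]; exact (exists_quantFun_eq hτ).choose_spec.1

lemma quantFun_complexInverse (hτ : ‖τ‖ ≤ 21 / 25) : quantFun (complexInverse τ) = τ := by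
  rw [complexInverse, dif_pos hτ]; exact (exists_quantFun_eq hτ).choose_spec.2

lemma complexInverse_quantFun (hτ : ‖quantFun z‖ ≤ 21 / 25) (hz : ‖z‖ ≤ 11 / 10) :
    complexInverse (quantFun z) = z := by
  have := norm_sub_le_of_quantFun_eq hτ (norm_complexInverse_le hτ) hz (quantFun_complexInverse hτ)
  rw [sub_self, norm_zero, mul_zero] at this
  exact sub_eq_zero.1 (norm_le_zero_iff.1 this)

lemma differentiableOn_complexInverse :
    DifferentiableOn ℂ complexInverse (Metric.ball 0 (21 / 25)) := by
  intro τ hτ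
  have hτ' : ‖τ‖ ≤ 21 / 25 := (mem_ball_zero_iff.1 hτ).le
  have hnear : ∀ᶠ σ in nhds τ, ‖σ‖ ≤ 21 / 25 := by
    filter_upwards [Metric.isOpen_ball.mem_nhds hτ] with σ hσ using (mem_ball_zero_iff.1 hσ).le
  have hz := norm_complexInverse_le hτ'
  have hS := quantFun_complexInverse hτ'
  have hcont : ContinuousAt complexInverse τ := by
    rw [ContinuousAt, tendsto_iff_norm_sub_tendsto_zero]
    have h0 : Filter.Tendsto (fun σ : ℂ => 3 * ‖τ - σ‖) (nhds τ) (nhds 0) := by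
      have : Continuous fun σ : ℂ => 3 * ‖τ - σ‖ := by fun_prop
      simpa using this.tendsto τ
    refine squeeze_zero' (Filter.Eventually.of_forall fun _ => norm_nonneg _) ?_ h0
    filter_upwards [hnear] with σ hσ
    have := norm_sub_le_of_quantFun_eq hσ (norm_complexInverse_le hσ) hz
      (quantFun_complexInverse hσ)
    rwa [hS] at this
  refine (HasDerivAt.of_local_left_inverse hcont (hasDerivAt_quantFun (by linarith)) ?_
    (hnear.mono fun σ hσ => quantFun_complexInverse hσ)).differentiableAt.differentiableWithinAt
  -- If S' vanished, `quantErrDeriv` would be 5zτ/12 - 1, of norm at least 0.615, against the bound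
  -- 1/25.
  intro h0
  have h1 := norm_quantErrDeriv_le hz
  rw [quantErrDeriv, h0, hS, zero_mul, zero_add] at h1
  have h2 : ‖5 / 12 * complexInverse τ * τ‖ ≤ 5 / 12 * (11 / 10) * (21 / 25) := by
    rw [norm_mul, norm_mul, show ‖(5 / 12 : ℂ)‖ = 5 / 12 by norm_num]
    gcongr
  have h3 := norm_sub_norm_le (1 : ℂ) (5 / 12 * complexInverse τ * τ)
  rw [norm_sub_rev, norm_one] at h3
  linarith

end ComplexInverse

/-! ### Exact arithmetic for the Taylor polynomial of the inverse -/

/-- Evaluation of the polynomial with the listed coefficients, lowest degree first. -/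
def listEval (l : List ℚ) (u : ℂ) : ℂ := l.foldr (fun a s => a + u * s) 0

end

/-- Addition of coefficient lists. -/
def listAdd : List ℚ → List ℚ → List ℚ
  | [], q => q
  | a :: p, [] => a :: p
  | a :: p, b :: q => (a + b) :: listAdd p q

/-- Multiplication of coefficient lists. -/
def listMul : List ℚ → List ℚ → List ℚ
  | [], _ => []
  | a :: p, q => listAdd (q.map (a * ·)) (0 :: listMul p q)

/-- Composition of coefficient lists. -/
def listComp : List ℚ → List ℚ → List ℚ
  | [], _ => []
  | a :: p, q => listAdd [a] (listMul q (listComp p q))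

/-- The coefficients of `z, z ^ 3, ..., z ^ 15` in `quantFun`. -/
def quantList : List ℚ :=
  [1, -5/24, 7/160, -19/1920, 2299/967680, -46189/77414400, 259369/1672151040,
    -48502003/1170505728000]

/-- The coefficients of `z, z ^ 3, ..., z ^ 15` in the inverse of `quantFun`. -/
def inverseList : List ℚ :=
  [1, 5/24, 83/960, 131/2880, 313319/11612160, 7993967/464486400, 12044441/1045094400,
    14030916199/1755758592000]

noncomputable section

@[simp] lemma listEval_nil (u : ℂ) : listEval [] u = 0 := rfl

@[simp] lemma listEval_cons (a : ℚ) (p : List ℚ) (u : ℂ) :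
    listEval (a :: p) u = a + u * listEval p u := rfl

lemma listEval_add (p q : List ℚ) (u : ℂ) :
    listEval (listAdd p q) u = listEval p u + listEval q u := by
  induction p generalizing q with
  | nil => simp [listAdd]
  | cons a p ih =>
    cases q with
    | nil => simp [listAdd]
    | cons b q => simp [listAdd, ih]; ring

lemma listEval_map_mul (a : ℚ) (p : List ℚ) (u : ℂ) :
    listEval (p.map (a * ·)) u = a * listEval p u := by
  induction p with
  | nil => simp
  | cons b p ih => simp [ih]; ring

lemma listEval_mul (p q : List ℚ) (u : ℂ) :
    listEval (listMul p q) u = listEval p u * listEval q u := by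
  induction p with
  | nil => simp [listMul]
  | cons a p ih => simp [listMul, listEval_add, listEval_map_mul, ih]; ring

lemma listEval_comp (p q : List ℚ) (u : ℂ) :
    listEval (listComp p q) u = listEval p (listEval q u) := by
  induction p with
  | nil => simp [listComp]
  | cons a p ih => simp [listComp, listEval_add, listEval_mul, ih]

lemma listEval_append (p q : List ℚ) (u : ℂ) :
    listEval (p ++ q) u = listEval p u + u ^ p.length * listEval q u := by
  induction p with
  | nil => simp
  | cons a p ih => simp [ih, pow_succ]; ring

lemma continuous_listEval (p : List ℚ) : Continuous (listEval p) := by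
  induction p with
  | nil => exact continuous_const
  | cons a p ih =>
    show Continuous fun u => (a : ℂ) + u * listEval p u
    fun_prop

lemma differentiable_listEval (p : List ℚ) : Differentiable ℂ (listEval p) := by
  induction p with
  | nil => exact differentiable_const _
  | cons a p ih =>
    show Differentiable ℂ fun u => (a : ℂ) + u * listEval p u
    fun_prop

/-- Odd series are stored as p with z p(z²). With u = τ², q for the inverse and p for S, this says
q(u) p(u q(u)²) = 1 modulo u⁸, that is, the composite is τ modulo τ¹⁷. -/
lemma take_listComp : (listMul inverseList (listComp quantList
    (0 :: listMul inverseList inverseList))).take 8 = [1, 0, 0, 0, 0, 0, 0, 0] := by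
  decide +kernel

/-- The Taylor polynomial of degree `15` of the inverse of `quantFun`. -/
def inversePoly (τ : ℂ) : ℂ := τ * listEval inverseList (τ ^ 2)

open Asymptotics Filter Topology

lemma exists_listEval_inverse_eq : ∃ R : List ℚ, ∀ u : ℂ,
    listEval inverseList u * listEval quantList (u * listEval inverseList u ^ 2) =
      1 + u ^ 8 * listEval R u := by
  set L := listMul inverseList (listComp quantList (0 :: listMul inverseList inverseList)) with hL
  refine ⟨L.drop 8, fun u => ?_⟩
  have h1 : listEval L u =
      listEval inverseList u * listEval quantList (u * listEval inverseList u ^ 2) := by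
    rw [hL, listEval_mul, listEval_comp, listEval_cons, listEval_mul]
    simp [pow_two]
  rw [← h1]
  conv_lhs => rw [← List.take_append_drop 8 L]
  rw [listEval_append, hL, take_listComp]
  simp

lemma sum_range_quantCoeff (z : ℂ) : ∑ n ∈ Finset.range 17, (quantCoeff n : ℂ) * z ^ n =
    z * listEval quantList (z ^ 2) := by
  simp [Finset.sum_range_succ, quantCoeff, quantList]
  ring

/-- The index 16 term vanishes by parity, so the degree 15 polynomial is accurate to order 17; 25/6
is (5/3) / (1 - 3/5). -/
lemma norm_quantFun_sub_listEval_le {z : ℂ} (hz : ‖z‖ ≤ 1) :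
    ‖quantFun z - z * listEval quantList (z ^ 2)‖ ≤ 25 / 6 * ‖z‖ ^ 17 := by
  have h := norm_sub_sum_range_le (quantFun_hasSum (𝕜 := ℂ) (z := z) (by linarith)) 17
    (A := 5 / 3 * ‖z‖ ^ 17) (r := 3 / 5) (by norm_num) (by norm_num) (fun j => by
      have h1 := abs_quantCoeff_add_le 17 (A := 5 / 3)
        (by norm_num [quantCoeff, abs_le]) (by norm_num [quantCoeff, abs_le]) j
      have h0 : ‖((quantCoeff (17 + j) : ℝ) : ℂ)‖ = |quantCoeff (17 + j)| :=
        RCLike.norm_ofReal _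
      have h2 : ‖z‖ ^ (17 + j) ≤ ‖z‖ ^ 17 :=
        pow_le_pow_of_le_one (norm_nonneg _) hz (Nat.le_add_right _ _)
      rw [norm_mul, norm_pow]
      calc ‖((quantCoeff (17 + j) : ℝ) : ℂ)‖ * ‖z‖ ^ (17 + j)
          ≤ (5 / 3 * (3 / 5) ^ j) * ‖z‖ ^ 17 := by
            rw [h0]; gcongr
        _ = _ := by ring)
  have hsum := sum_range_quantCoeff z
  rw [← hsum]
  refine h.trans (le_of_eq ?_)
  ring

lemma continuous_inversePoly : Continuous inversePoly := by
  have := continuous_listEval inverseList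
  unfold inversePoly
  fun_prop

lemma differentiable_inversePoly : Differentiable ℂ inversePoly := by
  have := differentiable_listEval inverseList
  unfold inversePoly
  fun_prop

lemma inversePoly_zero : inversePoly 0 = 0 := by simp [inversePoly]

lemma inversePoly_neg (τ : ℂ) : inversePoly (-τ) = -inversePoly τ := by simp [inversePoly]

/-- Two errors of order 17 add up: the tail of S at a point of size O(τ), and the remainder of the
polynomial composition. -/
lemma quantFun_inversePoly_isBigO :
    (fun τ => quantFun (inversePoly τ) - τ) =O[𝓝 0] fun τ : ℂ => τ ^ 17 := by
  obtain ⟨R, hR⟩ := exists_listEval_inverse_eq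
  have hcont : ∀ p : List ℚ, (fun τ : ℂ => listEval p (τ ^ 2)) =O[𝓝 0] fun _ : ℂ => (1 : ℂ) := by
    intro p
    have hc := continuous_listEval p
    have : Continuous fun τ : ℂ => listEval p (τ ^ 2) := by fun_prop
    exact this.continuousAt.tendsto.isBigO_one ℂ
  have hpoly : inversePoly =O[𝓝 0] fun τ : ℂ => τ := by
    simpa using! (isBigO_refl (fun τ : ℂ => τ) (𝓝 0)).mul (hcont inverseList)
  have hsmall : ∀ᶠ τ in 𝓝 (0 : ℂ), ‖inversePoly τ‖ ≤ 1 := by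
    have h : ContinuousAt (fun τ => ‖inversePoly τ‖) 0 := continuous_inversePoly.norm.continuousAt
    have h1 := h.tendsto
    rw [inversePoly_zero, norm_zero] at h1
    exact (h1.eventually_lt_const one_pos).mono fun _ h => h.le
  have h1 : (fun τ => quantFun (inversePoly τ) -
      inversePoly τ * listEval quantList (inversePoly τ ^ 2)) =O[𝓝 0] fun τ : ℂ => τ ^ 17 := by
    refine IsBigO.trans (IsBigO.of_bound (25 / 6) (hsmall.mono fun τ hτ => ?_)) (hpoly.pow 17)
    rw [norm_pow]
    exact norm_quantFun_sub_listEval_le hτ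
  have h2 : (fun τ => inversePoly τ * listEval quantList (inversePoly τ ^ 2) - τ) =O[𝓝 0]
      fun τ : ℂ => τ ^ 17 := by
    have he : (fun τ => inversePoly τ * listEval quantList (inversePoly τ ^ 2) - τ) =
        fun τ => τ ^ 17 * listEval R (τ ^ 2) := by
      funext τ
      have := hR (τ ^ 2)
      simp only [inversePoly, mul_pow]
      linear_combination τ * this
    rw [he]
    simpa using (isBigO_refl (fun τ : ℂ => τ ^ 17) (𝓝 0)).mul (hcont R)
  simpa using h1.add h2

/-- The remainder of the inverse of `quantFun` after its Taylor polynomial. -/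
def inverseRem (τ : ℂ) : ℂ := complexInverse τ - inversePoly τ

lemma inverseRem_isBigO : inverseRem =O[𝓝 0] fun τ : ℂ => τ ^ 17 := by
  refine IsBigO.trans (IsBigO.of_bound 3 ?_) quantFun_inversePoly_isBigO
  have hsmall : ∀ᶠ τ in 𝓝 (0 : ℂ), ‖inversePoly τ‖ ≤ 11 / 10 := by
    have h : ContinuousAt (fun τ => ‖inversePoly τ‖) 0 := continuous_inversePoly.norm.continuousAt
    have h1 := h.tendsto
    rw [inversePoly_zero, norm_zero] at h1
    exact (h1.eventually_lt_const (by norm_num : (0 : ℝ) < 11 / 10)).mono fun _ h => h.le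
  filter_upwards [hsmall, Metric.ball_mem_nhds (0 : ℂ) (by norm_num : (0 : ℝ) < 21 / 25)]
    with τ h1 h2
  have h3 : ‖τ‖ ≤ 21 / 25 := (mem_ball_zero_iff.1 h2).le
  exact norm_sub_le_of_quantFun_eq h3 (norm_complexInverse_le h3) h1 (quantFun_complexInverse h3)

/-- If the order of vanishing were k < N, then f = z^k g with g(0) ≠ 0, but the bound forces g =
O(z^(N-k)), which tends to 0. -/
lemma iteratedDeriv_eq_zero_of_isBigO {f : ℂ → ℂ} {N : ℕ} (hf : AnalyticAt ℂ f 0)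
    (hO : f =O[𝓝 0] fun z => z ^ N) {i : ℕ} (hi : i < N) : iteratedDeriv i f 0 = 0 := by
  refine (natCast_le_analyticOrderAt_iff_iteratedDeriv_eq_zero hf).1 ?_ i hi
  by_contra hlt
  rw [not_le] at hlt
  obtain ⟨k, hk⟩ := ENat.ne_top_iff_exists.1 (ne_top_of_lt hlt)
  rw [← hk, Nat.cast_lt] at hlt
  obtain ⟨g, hg, hg0, hfg⟩ := (hf.analyticOrderAt_eq_natCast).1 hk.symm
  obtain ⟨C, hC⟩ := hO.bound
  have hbd : ∀ᶠ z in 𝓝[≠] (0 : ℂ), ‖g z‖ ≤ C * ‖z‖ ^ (N - k) := by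
    filter_upwards [nhdsWithin_le_nhds hC, nhdsWithin_le_nhds hfg, self_mem_nhdsWithin]
      with z h1 h2 h3
    have hz : 0 < ‖z‖ := norm_pos_iff.2 h3
    rw [h2, sub_zero, smul_eq_mul, norm_mul, norm_pow, norm_pow] at h1
    refine le_of_mul_le_mul_left ?_ (pow_pos hz k)
    calc ‖z‖ ^ k * ‖g z‖ ≤ C * ‖z‖ ^ N := h1
      _ = ‖z‖ ^ k * (C * ‖z‖ ^ (N - k)) := by
        rw [show N = k + (N - k) by omega, pow_add, Nat.add_sub_cancel_left]; ring
  have hl : Tendsto (fun z => ‖g z‖) (𝓝[≠] 0) (𝓝 ‖g 0‖) :=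
    hg.continuousAt.norm.tendsto.mono_left nhdsWithin_le_nhds
  have hr : Tendsto (fun z : ℂ => C * ‖z‖ ^ (N - k)) (𝓝[≠] 0) (𝓝 0) := by
    have hc : Continuous fun z : ℂ => C * ‖z‖ ^ (N - k) := by fun_prop
    have := (hc.tendsto 0).mono_left (nhdsWithin_le_nhds (s := {0}ᶜ))
    simpa [zero_pow (by omega : N - k ≠ 0)] using this
  have := le_of_tendsto_of_tendsto hl hr hbd
  exact hg0 (norm_le_zero_iff.1 this)

lemma differentiableOn_inverseRem : DifferentiableOn ℂ inverseRem (Metric.ball 0 (21 / 25)) :=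
  differentiableOn_complexInverse.sub differentiable_inversePoly.differentiableOn

lemma iteratedDeriv_inverseRem {i : ℕ} (hi : i < 17) : iteratedDeriv i inverseRem 0 = 0 :=
  iteratedDeriv_eq_zero_of_isBigO (differentiableOn_inverseRem.analyticAt
    (Metric.ball_mem_nhds 0 (by norm_num))) inverseRem_isBigO hi

/-! ### Series expansion of the distribution function -/

/-- Odd Taylor coefficients of the inverse of the normalized quantile function. -/
def inverseCoeff (k : ℕ) : ℝ :=
  (((inverseList.getD k 0 : ℚ) : ℝ) +
    (((2 * k + 1).factorial : ℂ)⁻¹ * iteratedDeriv (2 * k + 1) inverseRem 0).re)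

/-- Here 2k + 1 ≤ 15 < 17, so the remainder contributes nothing and the coefficient is an exact
rational. -/
lemma inverseCoeff_of_lt {k : ℕ} (hk : k < 8) :
    inverseCoeff k = ((inverseList.getD k 0 : ℚ) : ℝ) := by
  rw [inverseCoeff, iteratedDeriv_inverseRem (by omega)]; simp

lemma hasSum_listEval (p : List ℚ) (u : ℂ) :
    HasSum (fun k => ((p.getD k 0 : ℚ) : ℂ) * u ^ k) (listEval p u) := by
  induction p with
  | nil => simp
  | cons a p ih =>
    rw [← hasSum_nat_add_iff' 1]
    convert! ih.mul_left u using 1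
    · funext k
      simp only [List.getD_cons_succ, pow_succ]
      ring
    · simp

/-- The inverse of the normalized quantile function is the sum of its odd Taylor series. -/
theorem hasSum_inverseCoeff {g : ℝ} (hg : |g| ≤ 1) (hS : |quantFun g| < 21 / 25) :
    HasSum (fun k => inverseCoeff k * quantFun g ^ (2 * k + 1)) g := by
  set τ : ℝ := quantFun g with hτ
  have hcast : quantFun (g : ℂ) = (τ : ℂ) := powSum_ofReal _ g
  have hnorm : ‖(τ : ℂ)‖ < 21 / 25 := by rwa [Complex.norm_real, Real.norm_eq_abs]
  have hgn : ‖(g : ℂ)‖ ≤ 11 / 10 := by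
    rw [Complex.norm_real, Real.norm_eq_abs]; linarith
  have hinv : complexInverse τ = g := by
    rw [← hcast]
    exact complexInverse_quantFun (by rw [hcast]; exact hnorm.le) hgn
  have hinv' : complexInverse (-τ) = -g := by
    rw [← hcast, ← quantFun_neg]
    exact complexInverse_quantFun (by rw [quantFun_neg, hcast, norm_neg]; exact hnorm.le)
      (by rwa [norm_neg])
  have hrem : inverseRem (-τ) = -inverseRem τ := by
    rw [inverseRem, inverseRem, hinv, hinv', inversePoly_neg]; ring
  have h1 := Complex.hasSum_taylorSeries_on_ball differentiableOn_inverseRem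
    (z := (τ : ℂ)) (mem_ball_zero_iff.2 hnorm)
  have h2 := Complex.hasSum_taylorSeries_on_ball differentiableOn_inverseRem
    (z := -(τ : ℂ)) (mem_ball_zero_iff.2 (by rwa [norm_neg]))
  -- Half the difference of the series at τ and -τ keeps only odd powers and, since the remainder is
  -- odd here, still sums to its value at τ.
  have h3 := (h1.sub h2).mul_left (1 / 2)
  rw [hrem, show (1 / 2 : ℂ) * (inverseRem τ - -inverseRem τ) = inverseRem τ by ring] at h3
  have hinj : Function.Injective fun k : ℕ => 2 * k + 1 := fun a b h => by simpa using h
  rw [← hinj.hasSum_iff] at h3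
  · have h4 := ((hasSum_listEval inverseList ((τ : ℂ) ^ 2)).mul_left (τ : ℂ)).add h3
    have h5 : (τ : ℂ) * listEval inverseList ((τ : ℂ) ^ 2) + inverseRem τ = g := by
      rw [inverseRem, hinv, inversePoly]; ring
    rw [h5] at h4
    -- Taking real parts avoids showing that the Taylor coefficients are real.
    have h6 := Complex.hasSum_re h4
    rw [Complex.ofReal_re] at h6
    refine h6.congr_fun fun k => ?_
    have hodd : (-(τ : ℂ)) ^ (2 * k + 1) = -(τ : ℂ) ^ (2 * k + 1) :=
      Odd.neg_pow ⟨k, rfl⟩ _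
    have e : (τ : ℂ) * (((inverseList.getD k 0 : ℚ) : ℂ) * ((τ : ℂ) ^ 2) ^ k) +
        1 / 2 * (((2 * k + 1).factorial : ℂ)⁻¹ • ((τ : ℂ) - 0) ^ (2 * k + 1) •
          iteratedDeriv (2 * k + 1) inverseRem 0 - ((2 * k + 1).factorial : ℂ)⁻¹ •
          (-(τ : ℂ) - 0) ^ (2 * k + 1) • iteratedDeriv (2 * k + 1) inverseRem 0) =
        ((((inverseList.getD k 0 : ℚ) : ℝ) : ℂ) + ((2 * k + 1).factorial : ℂ)⁻¹ *
          iteratedDeriv (2 * k + 1) inverseRem 0) * ((τ ^ (2 * k + 1) : ℝ) : ℂ) := by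
      simp only [sub_zero, hodd, smul_eq_mul]
      push_cast
      ring
    simp only [Function.comp]
    rw [e, Complex.re_mul_ofReal, Complex.add_re, Complex.ofReal_re, inverseCoeff]
  · intro n hn
    have heven : Even n := by
      by_contra hodd
      obtain ⟨k, hk⟩ := Nat.not_even_iff_odd.1 hodd
      exact hn ⟨k, hk.symm⟩
    simp [heven.neg_pow]

lemma symmetrization_cdf_eqMeasure :
    symmetrization (ProbabilityTheory.cdf eqMeasure) = invQuantile := by
  funext t
  rw [cdf_eqMeasure, symmetrization, eqCDF_apply, eqCDF_apply,
    show 2 * (1 / 2 + t / 2) - 1 = t by ring, show 2 * (1 / 2 - t / 2) - 1 = -t by ring,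
    invQuantile_neg]
  ring

lemma abs_quantFun_lt {g : ℝ} (hg : g ∈ Set.Icc (-1 : ℝ) 1) : |quantFun g| < 21 / 25 := by
  have h := quantile_mem hg
  have hs := quantScale_pos
  rw [quantile, halfWidth] at h
  have h1 : quantFun g ≤ quantFun 1 := le_of_mul_le_mul_left h.2 hs
  have h2 : -quantFun 1 ≤ quantFun g := le_of_mul_le_mul_left (by linarith [h.1]) hs
  have h3 := quantFun_one_bounds.2
  rw [abs_lt]
  constructor <;> linarith

/-- Odd Taylor coefficients of the equilibrium distribution function in `2 * x - 1`. -/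
def cdfCoeff (k : ℕ) : ℝ := inverseCoeff k / (2 * quantScale ^ (2 * k + 1))

lemma hasSum_cdfCoeff {x : ℝ} (hx : x ∈ Set.Icc leftEnd rightEnd) :
    HasSum (fun k : ℕ => cdfCoeff k * (2 * x - 1) ^ (2 * k + 1)) (eqCDF x - 1 / 2) := by
  obtain ⟨g, hg, rfl⟩ := exists_quantilePoint_eq hx
  have hs := quantScale_pos.ne'
  rw [eqCDF_quantilePoint hg, show (1 + g) / 2 - 1 / 2 = g / 2 by ring]
  refine ((hasSum_inverseCoeff (abs_le.2 hg) (abs_quantFun_lt hg)).div_const 2).congr_fun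
    fun k => ?_
  rw [cdfCoeff, quantilePoint, show 2 * ((1 + quantile g) / 2) - 1 = quantile g by ring, quantile,
    mul_pow]
  field_simp

lemma abs_cdfCoeff_sub_le (k : Fin 8) : |cdfCoeff k - printedCoeff k| ≤ 5e-6 := by
  obtain ⟨h1, h2⟩ := quantScale_bounds
  have hs := quantScale_pos
  -- The quotient is monotone in `quantScale`, so the error bound follows from rational inequalities
  -- at the ends of the enclosure.
  have key : ∀ (n : ℕ) (γ p : ℝ), (p - 5e-6) * (2 * 0.78559787 ^ n) ≤ γ →
      γ ≤ (p + 5e-6) * (2 * 0.78559785 ^ n) → 0 ≤ p - 5e-6 →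
      |γ / (2 * quantScale ^ n) - p| ≤ 5e-6 := by
    intro n γ p hl hu hp
    have hpos : 0 < 2 * quantScale ^ n := by positivity
    have e1 : quantScale ^ n ≤ 0.78559787 ^ n := by gcongr
    have e2 : 0.78559785 ^ n ≤ quantScale ^ n := by gcongr
    have f1 : p - 5e-6 ≤ γ / (2 * quantScale ^ n) := by
      rw [le_div_iff₀ hpos]
      refine le_trans ?_ hl
      gcongr
    have f2 : γ / (2 * quantScale ^ n) ≤ p + 5e-6 := by
      rw [div_le_iff₀ hpos]
      refine hu.trans ?_
      gcongr
      linarith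
    rw [abs_le]
    constructor <;> linarith
  rw [cdfCoeff, inverseCoeff_of_lt k.2]
  fin_cases k <;>
  · refine key _ _ _ ?_ ?_ ?_ <;> norm_num [inverseList, printedCoeff]

end

end ClosestWins

theorem theorem3p2 :
    ∃ (μ : MeasureTheory.Measure ℝ) (α β : ℝ) (c : ℕ → ℝ),
      -- each of the four players using `μ` is a solution, of value `0` for every player
      ClosestWins.IsNashEquilibrium (fun _ : Fin 4 => μ) ∧
      (∀ i, ClosestWins.expectedPayoff (fun _ : Fin 4 => μ) i = 0) ∧
      -- the distribution function is symmetric about `1/2`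
      (∀ t : ℝ, ProbabilityTheory.cdf μ (1 / 2 - t / 2) =
        1 - ProbabilityTheory.cdf μ (1 / 2 + t / 2)) ∧
      -- the support
      μ.support = Set.Icc α β ∧
      |α - 0.174989| ≤ 5e-7 ∧ |β - 0.825011| ≤ 5e-7 ∧
      -- the odd power series in `2x - 1` and its first eight coefficients
      (∀ x ∈ Set.Icc α β,
        HasSum (fun k : ℕ => c k * (2 * x - 1) ^ (2 * k + 1))
          (ProbabilityTheory.cdf μ x - 1 / 2)) ∧
      (∀ k : Fin 8, |c k - ClosestWins.printedCoeff k| ≤ 5e-6) ∧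
      -- the differential equation for the symmetrized distribution function
      (∀ t ∈ Set.Ioo (2 * α - 1) (2 * β - 1),
        ClosestWins.SatisfiesODEAt
          (ClosestWins.symmetrization (ProbabilityTheory.cdf μ)) t) := by
  open ClosestWins in
  obtain ⟨hb1, hb2⟩ := halfWidth_bounds
  refine ⟨eqMeasure, leftEnd, rightEnd, cdfCoeff, isNashEquilibrium_eqMeasure.1,
    isNashEquilibrium_eqMeasure.2, fun t => ?_, support_eqMeasure, ?_, ?_, fun x hx => ?_,
    abs_cdfCoeff_sub_le, fun t ht => ?_⟩
  · rw [cdf_eqMeasure, eqCDF_apply, eqCDF_apply, show 2 * (1 / 2 + t / 2) - 1 = t by ring,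
      show 2 * (1 / 2 - t / 2) - 1 = -t by ring, invQuantile_neg]
    ring
  · rw [leftEnd, abs_le]
    constructor <;> linarith
  · rw [rightEnd, abs_le]
    constructor <;> linarith
  · rw [cdf_eqMeasure]
    exact hasSum_cdfCoeff hx
  · rw [symmetrization_cdf_eqMeasure]
    rw [leftEnd, rightEnd] at ht
    exact invQuantile_satisfiesODEAt ⟨by linarith [ht.1], by linarith [ht.2]⟩
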